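/- **Setting.** Let $\hbar,m_e,e,B,a_1,a_2>0$, $0<\theta<\pi$, $\omega_c=eB/m_e$; consider the planar lattice with primitive vectors $a_1\mathbf e_x$ and $a_2(\cos\theta\,\mathbf e_x+\sin\theta\,\mathbf e_y)$, and put $G^x_n=2\pi n/a_1$, $G^y_m=2\pi m/a_2$, $G_{m,n}=(G^y_m-G^x_n\cos\theta)/\sin\theta$. For $\omega_p>0$ let $$m_p=\frac{m_e}{\omega_p^2},\quad m_c=\frac{m_e}{\omega_c^2},\quad M=\frac{m_p+m_c}2,\quad \mu=\frac{m_pm_c}{M},\quad \Omega=\sqrt{\omega_p^2+\omega_c^2},$$ $$G^w_{m,n}=\frac{G_{m,n}}{\sqrt2\,\omega_c},\quad G^v_{m,n}=\frac{m_pG_{m,n}}{\sqrt2M\omega_c},\quad A^{k_x}_n=\frac{\hbar(k_x+G^x_n)}{\sqrt2m_e},\quad \alpha_{n,m}=-\sqrt{\tfrac{\mu\Omega}{2\hbar}}A^0_n-i\sqrt{\tfrac{\hbar}{2\mu\Omega}}G^v_{m,n}.$$ Let $\langle\phi_i|\hat D(\alpha)|\phi_j\rangle$ be the matrix elements of the displacement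 operator $\hat D(\alpha)=\exp(\alpha\hat b^\dagger-\alpha^*\hat b)$ between normalised harmonic oscillator states. Let $V\in\ell^1(\mathbb Z^2)$ be the Fourier coefficients of a potential and $k_x,k_w\in\mathbb R$. The left-hand side of the 2D QED-Bloch central equation in row $(n,m,i)\in\mathbb Z^2\times\mathbb N$ is $$U_{n,m,i}\Big[\tfrac{\hbar^2(k_w+G^w_{m,n})^2}{2M}+\hbar\Omega(i+\tfrac12)-E\Big]+\sum_{n',m',j}V_{n-n',m-m'}U_{n',m',j}\,e^{-iG^v_{m-m',n-n'}A^{k_x}_{(n+n')/2}}\langle\phi_i|\hat D(\alpha_{n-n',m-m'})|\phi_j\rangle ,\qquad(1)$$ and the purely electronic (Landau-level/Bloch-wave) central equation is, for all $(n,i)\in\mathbb Z\times\mathbb N$, $$U_{n,i}\Big[\hbar\omega_c(i+\tfrac12)-E\Big]+\sum_{n',m',j}V_{n-n',m'}U_{n',j}\exp\Big(\tfrac{-i\hbar(k_x+\frac12G^x_{n+n'})G_{m',n-n'}}{m_e\omega_c}\Big)\langle\phi_i|\hat D(\beta_{n-n',m'})|\phi_j\rangle=0,\qquad(2)$$ where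 $\beta_{n,m}=\sqrt{\hbar/(2m_e\omega_c)}\,(-G^x_n-iG_{m,n})$. **Claim.** 1. As $\omega_p\to0^+$: $M\to\infty$, $\hbar^2(k_w+G^w_{m,n})^2/(2M)\to0$, $\Omega\to\omega_c$, $\mu\Omega\to2m_e/\omega_c$, $G^v_{m,n}\to\frac{\sqrt2}{\omega_c}G_{m,n}$ and $\alpha_{n,m}\to\beta_{n,m}$. 2. Let $\tilde u=u\sqrt{\hbar\omega_p/m_e}$, $\tilde y=\omega_cy$, $w=(m_p\tilde u+m_c\tilde y)/(\sqrt2M)$, $v=(\tilde u-\tilde y)/\sqrt2$, and let $\phi_j$ denote the normalised eigenfunctions of the oscillator of mass times frequency $\mu\Omega$. As $\omega_p\to0^+$ the QED-Bloch basis functions $e^{i(k_x+G^x_n)x+i(k_w+G^w_{m,n})w}\phi_j(v-A^{k_x}_n)$ converge, at every point $(x,y,u)$, to $e^{i(k_x+G^x_n)x}\phi_j(-\omega_cy/\sqrt2-A^{k_x}_n)$, in which $\phi_j$ is taken at $\mu\Omega=2m_e/\omega_c$; the limit is a Bloch wave in $x$ times a Landau level in $y$ and does not depend on $k_w$, $m$,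 $u$. 3. The sums in (1) and (2) converge absolutely whenever $\sup_{n,m}\|U_{n,m,\cdot}\|_{\ell^2}<\infty$, respectively $\sup_n\|U_{n,\cdot}\|_{\ell^2}<\infty$. Let $\omega_p^{(\nu)}\to0^+$, $E^{(\nu)}\to E$ in $\mathbb R$, and let $U^{(\nu)}$ satisfy $\sup_{\nu,n,m}\|U^{(\nu)}_{n,m,\cdot}\|_{\ell^2}<\infty$. (a) If $U^{(\nu)}_{n,m,j}\to U_{n,j}$ for all $n,m,j$ (the limit being independent of $m$), then for all $n,m,i$ the expression (1) converges to the left-hand side of (2) in row $(n,i)$. In particular $(U,E)$ solves (2) if and only if (1) tends to $0$ for all $n,m,i$, as it does when $U^{(\nu)}$ solves the QED-Bloch central equation with energy $E^{(\nu)}$. (b) If $U^{(\nu)}_{n,m,j}\to W_{n,m,j}$ for all $n,m,j$, with $\sup_n\sum_m\|W_{n,m,\cdot}\|_{\ell^2}<\infty$, and (1) tends to $0$ for all $n,m,i$, then $U_{n,j}=\sum_mW_{n,m,j}$ solves (2) with energy $E$. 4. Let $a_1=a_2=a$, $\theta=\pi/2$, $\Phi=Ba^2$, $\Phi_0=2\pi\hbar/e$,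 and let $V_{\pm1,0}=V_{0,\pm1}=V_0\in\mathbb R\setminus\{0\}$, all other $V_{n,m}=0$. For $E,k_x\in\mathbb R$ and any $(U_n)_{n\in\mathbb Z}$, the coefficients $U_{n,j}=U_n\delta_{j0}$ satisfy the rows $(n,0)$, $n\in\mathbb Z$, of (2) (the restriction of (2) to the lowest Landau level) if and only if Harper's equation $$\mathcal E\,U_n=U_{n-1}+U_{n+1}+2U_n\cos\Big(\frac{2\pi\Phi_0}{\Phi}\Big(\frac{ak_x}{2\pi}+n\Big)\Big)\qquad(n\in\mathbb Z)$$ holds with $\mathcal E=(E-\hbar\omega_c/2)/t(\Phi)$ and $t(\Phi)=V_0e^{-\pi\Phi_0/(2\Phi)}$. -/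

import Mathlib

open Filter Topology

noncomputable section

namespace QEDBloch

/-- Physical constants, magnetic field and two-dimensional Bravais lattice with primitive vectors
`a₁ e_x` and `a₂ (cos θ e_x + sin θ e_y)`. -/
structure Setting where
  hbar : ℝ
  me : ℝ
  e : ℝ
  B : ℝ
  a₁ : ℝ
  a₂ : ℝ
  θ : ℝ
  hbar_pos : 0 < hbar
  me_pos : 0 < me
  e_pos : 0 < e
  B_pos : 0 < B
  a₁_pos : 0 < a₁
  a₂_pos : 0 < a₂
  θ_pos : 0 < θ
  θ_lt_pi : θ < Real.pi

variable (P : Setting)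

/-! ### Frequencies, masses and reciprocal lattice -/

/-- Cyclotron frequency. -/
def ωc : ℝ := P.e * P.B / P.me

/-- Photonic mass parameter `m_p` (meaningful for diamagnetic frequency `ωp > 0`). -/
def mp (ωp : ℝ) : ℝ := P.me / ωp ^ 2

/-- Cyclotron mass parameter `m_c`. -/
def mc : ℝ := P.me / (ωc P) ^ 2

/-- `M = (m_p + m_c) / 2`. -/
def M (ωp : ℝ) : ℝ := (mp P ωp + mc P) / 2

/-- `μ = m_p m_c / M`. -/
def μ (ωp : ℝ) : ℝ := mp P ωp * mc P / M P ωp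

/-- Dressed frequency `Ω`. -/
def Ω (ωp : ℝ) : ℝ := √(ωp ^ 2 + (ωc P) ^ 2)

/-- `G^x_n`; a real index is allowed because half-integer indices occur. -/
def Gx (n : ℝ) : ℝ := 2 * Real.pi * n / P.a₁

/-- `G^y_m`. -/
def Gy (m : ℝ) : ℝ := 2 * Real.pi * m / P.a₂

/-- The `y`-component `G_{m,n}` of the reciprocal lattice vector with indices `(n, m)`. -/
def G (m n : ℝ) : ℝ := Gy P m / Real.sin P.θ - Gx P n * Real.cos P.θ / Real.sin P.θ

/-- `G^w_{m,n}`. -/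
def Gw (m n : ℝ) : ℝ := G P m n / (√2 * ωc P)

/-- `G^v_{m,n}`. -/
def Gv (ωp m n : ℝ) : ℝ := mp P ωp * G P m n / (√2 * M P ωp * ωc P)

/-- Shift `A^{k_x}_n` of the oscillator coordinate. -/
def A (kx n : ℝ) : ℝ := P.hbar * (kx + Gx P n) / (√2 * P.me)

/-- Magnetic flux quantum `Φ₀ = h / e`, with `h = 2πℏ`. -/
def Φ₀ : ℝ := 2 * Real.pi * P.hbar / P.e

/-- Magnetic flux through a unit cell. -/
def Φ : ℝ := P.B * (P.a₁ * P.a₂ * Real.sin P.θ)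

/-! ### Harmonic oscillator states and displacement operators -/

/-- The `j`-th normalised oscillator eigenfunction in the dimensionless coordinate. Mathlib's
`Polynomial.hermite` is the probabilists' polynomial, hence the argument `√2 ξ`. -/
def hermiteFn (j : ℕ) (ξ : ℝ) : ℝ :=
  (Real.pi ^ (1 / 4 : ℝ))⁻¹ * (√(j.factorial : ℝ))⁻¹ *
    Polynomial.aeval (√2 * ξ) (Polynomial.hermite j) * Real.exp (-ξ ^ 2 / 2)

/-- The eigenfunction `φ_j` of an oscillator of mass `μ'` and frequency `Ω'`, where
`lam = μ' Ω' / ℏ`. -/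
def oscFn (lam : ℝ) (j : ℕ) (s : ℝ) : ℝ := lam ^ (1 / 4 : ℝ) * hermiteFn j (√lam * s)

/-- The displacement operator `D(α) = exp(α b† - α* b)`, where `b = (ξ + d/dξ) / √2` and
`b† = (ξ - d/dξ) / √2`, acting on functions of the dimensionless coordinate `ξ`. -/
def displacement (α : ℂ) (f : ℝ → ℂ) (ξ : ℝ) : ℂ :=
  Complex.exp (Complex.I * ((√2 * α.im * ξ - α.re * α.im : ℝ) : ℂ)) * f (ξ - √2 * α.re)

/-- The composition law of displacement operators. -/
theorem displacement_comp (α γ : ℂ) (f : ℝ → ℂ) (ξ : ℝ) :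
    displacement α (displacement γ f) ξ =
      Complex.exp ((α * (starRingEnd ℂ) γ - (starRingEnd ℂ) α * γ) / 2) *
        displacement (α + γ) f ξ := by
  have h2 : (√2 : ℝ) * √2 = 2 := Real.mul_self_sqrt (by norm_num)
  have h2' : ((√2 : ℝ) : ℂ) * ((√2 : ℝ) : ℂ) = 2 := by exact_mod_cast h2
  have hc : (α * (starRingEnd ℂ) γ - (starRingEnd ℂ) α * γ) / 2 =
      Complex.I * ((α.im * γ.re - α.re * γ.im : ℝ) : ℂ) := by
    apply Complex.ext
    · simp
    · simp; ring
  have hf : ξ - √2 * α.re - √2 * γ.re = ξ - √2 * (α + γ).re := by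
    rw [Complex.add_re]; ring
  unfold displacement
  rw [hc, hf, ← mul_assoc, ← mul_assoc, ← Complex.exp_add, ← Complex.exp_add]
  congr 2
  rw [← mul_add, ← mul_add]
  congr 1
  rw [← Complex.ofReal_add, ← Complex.ofReal_add]
  congr 1
  rw [Complex.add_re, Complex.add_im]
  linear_combination (-(γ.im * α.re)) * h2

/-- The generator of `t ↦ D(t α)` is `α b† - α* b`. -/
theorem displacement_generator (α : ℂ) (f : ℝ → ℂ) (f' : ℂ) (ξ : ℝ) (hf : HasDerivAt f f' ξ) :
    HasDerivAt (fun t : ℝ => displacement ((t : ℂ) * α) f ξ)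
      (α * ((ξ * f ξ - f') / √2) - (starRingEnd ℂ) α * ((ξ * f ξ + f') / √2)) 0 := by
  have h2 : (√2 : ℝ) * √2 = 2 := Real.mul_self_sqrt (by norm_num)
  have h2' : ((√2 : ℝ) : ℂ) * ((√2 : ℝ) : ℂ) = 2 := by exact_mod_cast h2
  have hne : ((√2 : ℝ) : ℂ) ≠ 0 := by
    intro h; rw [h] at h2'; norm_num at h2'
  have hre : ∀ t : ℝ, ((t : ℂ) * α).re = t * α.re := fun t => by simp
  have him : ∀ t : ℝ, ((t : ℂ) * α).im = t * α.im := fun t => by simp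
  have hin : HasDerivAt (fun t : ℝ => ξ - √2 * (t * α.re)) (-(√2 * α.re)) 0 := by
    have := (((hasDerivAt_id (0 : ℝ)).mul_const α.re).const_mul (√2)).const_sub ξ
    simpa using this
  have hfc : HasDerivAt (fun t : ℝ => f (ξ - √2 * (t * α.re))) ((-(√2 * α.re)) • f') 0 := by
    have hf0 : HasDerivAt f f' (ξ - √2 * (0 * α.re)) := by simpa using hf
    exact hf0.scomp 0 hin
  have hph : HasDerivAt (fun t : ℝ => √2 * (t * α.im) * ξ - (t * α.re) * (t * α.im))
      (√2 * α.im * ξ) 0 := by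
    have h1 := (((hasDerivAt_id (0 : ℝ)).mul_const α.im).const_mul (√2)).mul_const ξ
    have h3 := ((hasDerivAt_id (0 : ℝ)).mul_const α.re).mul
      ((hasDerivAt_id (0 : ℝ)).mul_const α.im)
    refine (h1.sub h3).congr_deriv ?_
    simp
  have hex := ((hph.ofReal_comp).const_mul Complex.I).cexp
  have hall := hex.mul hfc
  simp only [displacement, hre, him]
  refine hall.congr_deriv ?_
  have hα : α = α.re + α.im * Complex.I := (Complex.re_add_im α).symm
  have hcα : (starRingEnd ℂ) α = α.re - α.im * Complex.I := by
    apply Complex.ext <;> simp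
  rw [hcα]
  simp
  field_simp
  linear_combination (-(α.re * f') + Complex.I * ξ * f ξ * α.im) * h2' -
    (ξ * f ξ - f') * hα

/-- Matrix elements `⟨φ_i| D(α) |φ_j⟩` of the displacement operator in the oscillator basis. -/
def dispElem (α : ℂ) (i j : ℕ) : ℂ :=
  ∫ ξ : ℝ, (starRingEnd ℂ) (hermiteFn i ξ : ℂ) * displacement α (fun x => (hermiteFn j x : ℂ)) ξ

/-! ### The two-dimensional QED-Bloch central equation -/

/-- `α_{n,m}`. -/
def alphaMat (ωp : ℝ) (n m : ℤ) : ℂ :=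
  -((√(μ P ωp * Ω P ωp / (2 * P.hbar)) * A P 0 n : ℝ) : ℂ) -
    Complex.I * ((√(P.hbar / (2 * μ P ωp * Ω P ωp)) * Gv P ωp m n : ℝ) : ℂ)

/-- Kinetic energy in the polaritonic direction `w`. -/
def kinetic (ωp kw : ℝ) (n m : ℤ) : ℝ := P.hbar ^ 2 * (kw + Gw P m n) ^ 2 / (2 * M P ωp)

/-- The summand, indexed by `(n', m', j)`, of the potential term in row `(n, m, i)`. -/
def qedTerm (V : ℤ → ℤ → ℂ) (ωp kx : ℝ) (U : ℤ → ℤ → ℕ → ℂ) (n m : ℤ) (i : ℕ)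
    (q : ℤ × ℤ × ℕ) : ℂ :=
  V (n - q.1) (m - q.2.1) * U q.1 q.2.1 q.2.2 *
    Complex.exp (-Complex.I *
      ((Gv P ωp ((m - q.2.1 : ℤ) : ℝ) ((n - q.1 : ℤ) : ℝ) * A P kx (((n : ℝ) + q.1) / 2) : ℝ) : ℂ)) *
    dispElem (alphaMat P ωp (n - q.1) (m - q.2.1)) i q.2.2

/-- Left-hand side, in row `(n, m, i)`, of the two-dimensional QED-Bloch central equation. -/
def qedLHS (V : ℤ → ℤ → ℂ) (ωp kx kw : ℝ) (U : ℤ → ℤ → ℕ → ℂ) (E : ℝ) (n m : ℤ) (i : ℕ) : ℂ :=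
  U n m i * ((kinetic P ωp kw n m + P.hbar * Ω P ωp * ((i : ℝ) + 1 / 2) - E : ℝ) : ℂ) +
    ∑' q : ℤ × ℤ × ℕ, qedTerm P V ωp kx U n m i q

/-- Scaled photonic coordinate `ũ = u √(ℏ ωp / m_e)`. -/
def uTilde (ωp u : ℝ) : ℝ := u * √(P.hbar * ωp / P.me)

/-- Polaritonic coordinate `w` as a function of the photonic coordinate `u` and of `y`. -/
def wCoord (ωp u y : ℝ) : ℝ :=
  (mp P ωp * uTilde P ωp u + mc P * (ωc P * y)) / (√2 * M P ωp)

/-- Polaritonic coordinate `v` as a function of the photonic coordinate `u` and of `y`. -/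
def vCoord (ωp u y : ℝ) : ℝ := (uTilde P ωp u - ωc P * y) / √2

/-- The basis function with labels `(n, m, j)` of the QED-Bloch ansatz, at the point `(x, y, u)` of
the electronic plus photonic configuration space. -/
def qedBasis (ωp kx kw : ℝ) (n m : ℤ) (j : ℕ) (x y u : ℝ) : ℂ :=
  Complex.exp (Complex.I *
      (((kx + Gx P n) * x + (kw + Gw P m n) * wCoord P ωp u y : ℝ) : ℂ)) *
    (oscFn (μ P ωp * Ω P ωp / P.hbar) j (vCoord P ωp u y - A P kx n) : ℂ)

/-! ### The central equation in the Landau-level/Bloch-wave basis -/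

/-- `β_{n,m}`. -/
def betaMat (n m : ℤ) : ℂ :=
  (√(P.hbar / (2 * P.me * ωc P)) : ℂ) * (-(Gx P n : ℂ) - Complex.I * (G P m n : ℂ))

/-- The summand, indexed by `(n', m', j)`, of the potential term in row `(n, i)`. -/
def llbTerm (V : ℤ → ℤ → ℂ) (kx : ℝ) (U : ℤ → ℕ → ℂ) (n : ℤ) (i : ℕ) (q : ℤ × ℤ × ℕ) : ℂ :=
  V (n - q.1) q.2.1 * U q.1 q.2.2 *
    Complex.exp (-Complex.I *
      ((P.hbar * (kx + 1 / 2 * Gx P ((n + q.1 : ℤ) : ℝ)) * G P (q.2.1 : ℝ) ((n - q.1 : ℤ) : ℝ) /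
        (P.me * ωc P) : ℝ) : ℂ)) *
    dispElem (betaMat P (n - q.1) q.2.1) i q.2.2

/-- Left-hand side, in row `(n, i)`, of the purely electronic central equation. -/
def llbLHS (V : ℤ → ℤ → ℂ) (kx : ℝ) (U : ℤ → ℕ → ℂ) (E : ℝ) (n : ℤ) (i : ℕ) : ℂ :=
  U n i * ((P.hbar * ωc P * ((i : ℝ) + 1 / 2) - E : ℝ) : ℂ) +
    ∑' q : ℤ × ℤ × ℕ, llbTerm P V kx U n i q

/-- Row `(n, i)` of the purely electronic central equation holds (with convergent potential
term). -/
def LLBRow (V : ℤ → ℤ → ℂ) (kx : ℝ) (U : ℤ → ℕ → ℂ) (E : ℝ) (n : ℤ) (i : ℕ) : Prop :=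
  Summable (llbTerm P V kx U n i) ∧ llbLHS P V kx U E n i = 0

/-- The basis function with labels `(n, j)`: a Bloch wave in `x` times a Landau level in `y`. -/
def llbBasis (kx : ℝ) (n : ℤ) (j : ℕ) (x y : ℝ) : ℂ :=
  Complex.exp (Complex.I * (((kx + Gx P n) * x : ℝ) : ℂ)) *
    (oscFn (2 * P.me / (P.hbar * ωc P)) j (-(ωc P * y) / √2 - A P kx n) : ℂ)

/-! ### Coefficient sequences -/

/-- The sequence `c` of oscillator coefficients is square summable with `ℓ²` norm at most `C`. -/
def L2Bound (C : ℝ) (c : ℕ → ℂ) : Prop :=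
  Summable (fun j => ‖c j‖ ^ 2) ∧ √(∑' j, ‖c j‖ ^ 2) ≤ C

/-! ### Square cosine potential, lowest Landau level and Harper's equation -/

/-- Fourier coefficients of the square cosine potential. -/
def cosinePotential (V₀ : ℝ) (n m : ℤ) : ℂ :=
  if (n = 1 ∧ m = 0) ∨ (n = -1 ∧ m = 0) ∨ (n = 0 ∧ m = 1) ∨ (n = 0 ∧ m = -1) then (V₀ : ℂ) else 0

/-- Coefficients with only the lowest Landau level `j = 0` occupied. -/
def lowestLevel (u : ℤ → ℂ) (n : ℤ) (j : ℕ) : ℂ := if j = 0 then u n else 0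

/-- Flux-dependent hopping `t(Φ)`. -/
def hopping (V₀ : ℝ) : ℝ := V₀ * Real.exp (-(Real.pi * Φ₀ P) / (2 * Φ P))

/-- Harper's equation with frequency `f`, offset `κ` and energy `ℰ`. -/
def Harper (f κ ℰ : ℝ) (u : ℤ → ℂ) : Prop :=
  ∀ n : ℤ, (ℰ : ℂ) * u n =
    u (n - 1) + u (n + 1) + 2 * u n * (Real.cos (2 * Real.pi * f * (κ + n)) : ℂ)

end QEDBloch

end

open QEDBloch

namespace QEDBloch

open MeasureTheory Polynomial

/-! ### Polynomials against the Gaussian weight -/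

/-! The parameter limits are elementary: `M` diverges, `mp / M` tends to 2, and the other limits
follow. The real question is the passage to the limit inside the sum over `(n', m', j)`, where the
coefficients are only bounded in `ℓ²` and converge coordinatewise, hence merely weakly in `j`.

Compactness is supplied by the matrix elements. Since the adjoint of `D(α)` is `D(-α)`, the row `j ↦
dispElem α i j` lists the conjugated Hermite coefficients of the unit vector `D(-α) φ_i`. Bessel's
inequality, which needs orthonormality but not completeness of the Hermite functions, bounds each
row by 1 in `ℓ²`. It also bounds the distance between two rows by the `L²` distance of the displaced
states, which vanishes as the parameters merge, by dominated convergence. Pairing weakly with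
strongly convergent sequences settles the sum over `j`, and dominated convergence with majorant a
constant times `‖V‖` settles the sum over Fourier labels (`tendsto_tsum_row`, `tendsto_qedLHS`).

In the limit the potential term sees `m` and `m'` through `m - m'`, apart from the coefficients
themselves. The reflection `m' ↦ m - m'` therefore gives the electronic equation, with coefficients
shifted in `m`. Coefficients independent of `m` do not feel the shift; otherwise Fubini and a sum
over `m` remove it (`llbRow_of_summed_labels`).

For Harper's equation four terms survive. They share one Gaussian factor, and the two with `n' = n`
carry opposite phases that add up to the cosine. -/

theorem exists_abs_eval_le_exp_abs (p : ℝ[X]) :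
    ∃ C : ℝ, 0 ≤ C ∧ ∀ x : ℝ, |p.eval x| ≤ C * Real.exp |x| := by
  induction p using Polynomial.induction_on' with
  | add p q hp hq =>
    obtain ⟨C, hC, h⟩ := hp
    obtain ⟨D, hD, k⟩ := hq
    refine ⟨C + D, by positivity, fun x => ?_⟩
    rw [eval_add, add_mul]
    exact (abs_add_le _ _).trans (add_le_add (h x) (k x))
  | monomial n a =>
    refine ⟨|a| * n.factorial, by positivity, fun x => ?_⟩
    rw [eval_monomial, abs_mul, abs_pow, mul_assoc]
    gcongr
    have := Real.pow_div_factorial_le_exp |x| (abs_nonneg x) n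
    rwa [div_le_iff₀' (by positivity)] at this

theorem integrable_eval_mul_gaussian (p : ℝ[X]) :
    Integrable (fun x : ℝ => p.eval x * Real.exp (-x ^ 2 / 2)) := by
  obtain ⟨C, hC, h⟩ := exists_abs_eval_le_exp_abs p
  refine ((integrable_exp_neg_mul_sq (b := 1 / 4) (by norm_num)).const_mul
    (C * Real.exp 1)).mono' (by fun_prop) (Eventually.of_forall fun x => ?_)
  rw [norm_mul, Real.norm_eq_abs, Real.norm_eq_abs, Real.abs_exp]
  calc |p.eval x| * Real.exp (-x ^ 2 / 2) ≤ C * Real.exp |x| * Real.exp (-x ^ 2 / 2) := by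
        gcongr; exact h x
    _ = C * Real.exp (|x| + -x ^ 2 / 2) := by rw [mul_assoc, ← Real.exp_add]
    _ ≤ C * Real.exp (1 + -(1 / 4) * x ^ 2) := by
        -- `(|x| - 2)² ≥ 0` gives `|x| ≤ 1 + x² / 4`, so half of the Gaussian absorbs the growth.
        refine mul_le_mul_of_nonneg_left (Real.exp_le_exp.2 ?_) hC
        nlinarith [sq_nonneg (|x| - 2), sq_abs x]
    _ = C * Real.exp 1 * Real.exp (-(1 / 4) * x ^ 2) := by rw [mul_assoc, ← Real.exp_add]

theorem hasDerivAt_gaussian (x : ℝ) :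
    HasDerivAt (fun x : ℝ => Real.exp (-x ^ 2 / 2)) (-x * Real.exp (-x ^ 2 / 2)) x := by
  have h : HasDerivAt (fun x : ℝ => -x ^ 2 / 2) (-x) x :=
    (((hasDerivAt_pow 2 x).neg).div_const 2).congr_deriv (by simp; ring)
  simpa [mul_comm] using h.exp

/-- The integrand is the derivative of `p` times the Gaussian; this is the integration by parts
behind orthogonality. -/
theorem integral_derivative_sub_X_mul (p : ℝ[X]) :
    ∫ x : ℝ, (derivative p - X * p).eval x * Real.exp (-x ^ 2 / 2) = 0 := by
  refine integral_eq_zero_of_hasDerivAt_of_integrable (f := fun x : ℝ =>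
    p.eval x * Real.exp (-x ^ 2 / 2)) (fun x => ?_) (integrable_eval_mul_gaussian _)
    (integrable_eval_mul_gaussian p)
  refine ((p.hasDerivAt x).mul (hasDerivAt_gaussian x)).congr_deriv ?_
  simp only [eval_sub, eval_mul, eval_X]
  ring

/-- Differentiating the recursion for `hermite` leaves a combination that the recursion one step
lower collapses. -/
theorem derivative_hermite_succ (n : ℕ) :
    derivative (hermite (n + 1)) = ((n : ℤ[X]) + 1) * hermite n := by
  induction n with
  | zero => simp
  | succ n ih =>
    rw [hermite_succ (n + 1), derivative_sub, derivative_mul, derivative_X, ih, derivative_mul]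
    have h := hermite_succ n
    simp only [derivative_add, derivative_natCast, derivative_one]
    push_cast
    linear_combination -((n : ℤ[X]) + 1) * h

/-- The probabilists' Hermite polynomial with real coefficients. -/
noncomputable def realHermite (n : ℕ) : ℝ[X] := (hermite n).map (Int.castRingHom ℝ)

theorem realHermite_zero : realHermite 0 = 1 := by simp [realHermite]

theorem realHermite_succ (n : ℕ) :
    realHermite (n + 1) = X * realHermite n - derivative (realHermite n) := by
  simp [realHermite, hermite_succ, Polynomial.derivative_map]

theorem derivative_realHermite_succ (n : ℕ) :
    derivative (realHermite (n + 1)) = ((n : ℝ[X]) + 1) * realHermite n := by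
  rw [realHermite, Polynomial.derivative_map, derivative_hermite_succ]
  simp [realHermite]

theorem aeval_hermite (n : ℕ) (x : ℝ) : aeval x (hermite n) = (realHermite n).eval x := by
  rw [realHermite, eval_map, aeval_def]
  rfl

/-- The Gaussian pairing of two Hermite polynomials. -/
noncomputable def hermitePairing (m n : ℕ) : ℝ :=
  ∫ x : ℝ, (realHermite m * realHermite n).eval x * Real.exp (-x ^ 2 / 2)

theorem hermitePairing_comm (m n : ℕ) : hermitePairing m n = hermitePairing n m := by
  simp only [hermitePairing, mul_comm (realHermite m)]

/-- The raising operator `X - d/dx` is adjoint to `d/dx` for the Gaussian weight. With the lowering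
rule it reduces both indices together. -/
theorem hermitePairing_succ_right (m n : ℕ) : hermitePairing m (n + 1) =
    ∫ x : ℝ, (derivative (realHermite m) * realHermite n).eval x * Real.exp (-x ^ 2 / 2) := by
  have h := integral_derivative_sub_X_mul (realHermite m * realHermite n)
  have e : derivative (realHermite m * realHermite n) - X * (realHermite m * realHermite n) =
      derivative (realHermite m) * realHermite n - realHermite m * realHermite (n + 1) := by
    rw [derivative_mul, realHermite_succ]; ring
  simp only [e, eval_sub, sub_mul] at h
  rw [integral_sub (integrable_eval_mul_gaussian _) (integrable_eval_mul_gaussian _),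
    sub_eq_zero] at h
  exact h.symm

theorem hermitePairing_zero_succ (n : ℕ) : hermitePairing 0 (n + 1) = 0 := by
  simp [hermitePairing_succ_right, realHermite_zero]

theorem hermitePairing_succ_succ (m n : ℕ) :
    hermitePairing (m + 1) (n + 1) = (m + 1) * hermitePairing m n := by
  rw [hermitePairing_succ_right, derivative_realHermite_succ, hermitePairing,
    ← integral_const_mul]
  congr 1 with x
  simp only [eval_mul, eval_add, eval_natCast, eval_one]
  ring

theorem hermitePairing_zero_zero : hermitePairing 0 0 = √(2 * Real.pi) := by
  have h := integral_gaussian (1 / 2)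
  rw [show Real.pi / (1 / 2) = 2 * Real.pi by ring] at h
  rw [hermitePairing, ← h]
  congr 1 with x
  simp only [realHermite_zero, mul_one, eval_one, one_mul]
  congr 1; ring

theorem hermitePairing_eq (m n : ℕ) :
    hermitePairing m n = if m = n then (m.factorial : ℝ) * √(2 * Real.pi) else 0 := by
  induction m generalizing n with
  | zero =>
    cases n with
    | zero => simp [hermitePairing_zero_zero]
    | succ n => simp [hermitePairing_zero_succ]
  | succ m ih =>
    cases n with
    | zero => rw [hermitePairing_comm, hermitePairing_zero_succ]; simp
    | succ n =>
      rw [hermitePairing_succ_succ, ih]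
      by_cases h : m = n
      · simp [h, Nat.factorial_succ, mul_assoc]
      · simp [h]

/-! ### Hermite functions -/

theorem hermiteFn_eq (j : ℕ) (ξ : ℝ) : hermiteFn j ξ =
    (Real.pi ^ (1 / 4 : ℝ))⁻¹ * (√(j.factorial : ℝ))⁻¹ *
      (realHermite j).eval (√2 * ξ) * Real.exp (-ξ ^ 2 / 2) := by
  rw [hermiteFn, aeval_hermite]

@[fun_prop]
theorem continuous_hermiteFn (j : ℕ) : Continuous (hermiteFn j) := by
  simp only [funext (hermiteFn_eq j)]
  fun_prop

/-- The substitution `x = √2 ξ` turns the product of two Gaussians into the probabilists' weight;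
its Jacobian cancels the `√2` in `√(2π)`. -/
theorem integral_hermiteFn_mul (i j : ℕ) :
    ∫ ξ : ℝ, hermiteFn i ξ * hermiteFn j ξ = if i = j then 1 else 0 := by
  have h2 : √2 * √2 = (2 : ℝ) := Real.mul_self_sqrt (by norm_num)
  have e : ∀ ξ : ℝ, hermiteFn i ξ * hermiteFn j ξ =
      ((Real.pi ^ (1 / 4 : ℝ))⁻¹ * (√(i.factorial : ℝ))⁻¹ *
        ((Real.pi ^ (1 / 4 : ℝ))⁻¹ * (√(j.factorial : ℝ))⁻¹)) *
      (fun x : ℝ => (realHermite i * realHermite j).eval x * Real.exp (-x ^ 2 / 2)) (√2 * ξ) := by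
    intro ξ
    have : Real.exp (-ξ ^ 2 / 2) * Real.exp (-ξ ^ 2 / 2) = Real.exp (-(√2 * ξ) ^ 2 / 2) := by
      rw [← Real.exp_add]; congr 1; linear_combination ξ ^ 2 / 2 * h2
    simp only [hermiteFn_eq, eval_mul]
    rw [← this]; ring
  simp only [e]
  rw [integral_const_mul, Measure.integral_comp_mul_left
    (fun x : ℝ => (realHermite i * realHermite j).eval x * Real.exp (-x ^ 2 / 2))]
  have hp := hermitePairing_eq i j
  rw [hermitePairing] at hp
  rw [hp]
  split_ifs with h
  · subst h
    have hf : √(i.factorial : ℝ) * √(i.factorial : ℝ) = i.factorial :=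
      Real.mul_self_sqrt (by positivity)
    have hf0 : 0 < √(i.factorial : ℝ) := by positivity
    have hπ : Real.pi ^ (1 / 4 : ℝ) * Real.pi ^ (1 / 4 : ℝ) = √Real.pi := by
      rw [← Real.rpow_add Real.pi_pos, Real.sqrt_eq_rpow]; norm_num
    have hπ0 : 0 < Real.pi ^ (1 / 4 : ℝ) := Real.rpow_pos_of_pos Real.pi_pos _
    have h20 : (0 : ℝ) < √2 := by positivity
    rw [Real.sqrt_mul (by norm_num), ← hπ, abs_of_pos (inv_pos.2 h20), smul_eq_mul]
    field_simp
    rw [sq, hf]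
  · simp

theorem exists_hermiteFn_le (j : ℕ) :
    ∃ C : ℝ, 0 ≤ C ∧ ∀ ξ : ℝ, |hermiteFn j ξ| ≤ C * Real.exp (-ξ ^ 2 / 4) := by
  obtain ⟨C, hC, h⟩ := exists_abs_eval_le_exp_abs (realHermite j)
  have hc : 0 ≤ (Real.pi ^ (1 / 4 : ℝ))⁻¹ * (√(j.factorial : ℝ))⁻¹ := by positivity
  refine ⟨(Real.pi ^ (1 / 4 : ℝ))⁻¹ * (√(j.factorial : ℝ))⁻¹ * (C * Real.exp 4), by positivity,
    fun ξ => ?_⟩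
  rw [hermiteFn_eq, abs_mul, abs_mul, abs_of_nonneg hc, Real.abs_exp, mul_assoc, mul_assoc _ _
    (Real.exp (-ξ ^ 2 / 4))]
  refine mul_le_mul_of_nonneg_left ?_ hc
  have h2 : √2 ≤ (2 : ℝ) := by
    rw [Real.sqrt_le_left (by norm_num)]; norm_num
  calc |(realHermite j).eval (√2 * ξ)| * Real.exp (-ξ ^ 2 / 2)
      ≤ C * Real.exp |√2 * ξ| * Real.exp (-ξ ^ 2 / 2) := by gcongr; exact h _
    _ = C * Real.exp (|√2 * ξ| + -ξ ^ 2 / 2) := by rw [mul_assoc, ← Real.exp_add]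
    _ ≤ C * Real.exp (4 + -ξ ^ 2 / 4) := by
        -- The constant 4 comes from `√2 |ξ| ≤ 2 |ξ| ≤ 4 + ξ² / 4`.
        refine mul_le_mul_of_nonneg_left (Real.exp_le_exp.2 ?_) hC
        rw [abs_mul, abs_of_nonneg (Real.sqrt_nonneg 2)]
        nlinarith [sq_nonneg (|ξ| - 4), sq_abs ξ, abs_nonneg ξ]
    _ = C * Real.exp 4 * Real.exp (-ξ ^ 2 / 4) := by rw [mul_assoc, ← Real.exp_add]

open MeasureTheory ComplexConjugate

/-! ### Bessel's inequality for the Hermite functions -/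

theorem memLp_two_of_norm_le_gaussian {f : ℝ → ℂ} (hf : Continuous f) {C b : ℝ} (hb : 0 < b)
    (h : ∀ ξ, ‖f ξ‖ ≤ C * Real.exp (-b * ξ ^ 2)) : MemLp f 2 volume := by
  rw [memLp_two_iff_integrable_sq_norm hf.aestronglyMeasurable]
  refine ((integrable_exp_neg_mul_sq (b := 2 * b) (by positivity)).const_mul (C ^ 2)).mono'
    (by fun_prop) (Eventually.of_forall fun ξ => ?_)
  rw [Real.norm_of_nonneg (by positivity)]
  calc ‖f ξ‖ ^ 2 ≤ (C * Real.exp (-b * ξ ^ 2)) ^ 2 := by gcongr; exact h ξ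
    _ = C ^ 2 * Real.exp (-(2 * b) * ξ ^ 2) := by
      rw [mul_pow, ← Real.exp_nat_mul]; congr 2; push_cast; ring

theorem memLp_hermiteFn (j : ℕ) : MemLp (fun ξ => (hermiteFn j ξ : ℂ)) 2 volume := by
  obtain ⟨C, _, h⟩ := exists_hermiteFn_le j
  refine memLp_two_of_norm_le_gaussian (by fun_prop) (b := 1 / 4) (C := C) (by norm_num)
    fun ξ => ?_
  rw [Complex.norm_real, Real.norm_eq_abs]
  convert h ξ using 3
  ring

theorem orthonormal_hermiteFn : Orthonormal ℂ (fun j => (memLp_hermiteFn j).toLp _) := by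
  rw [orthonormal_iff_ite]
  intro i j
  rw [L2.inner_def]
  have h : ∫ ξ : ℝ, (hermiteFn i ξ : ℂ) * hermiteFn j ξ = if i = j then 1 else 0 := by
    have := congrArg (fun r : ℝ => (r : ℂ)) (integral_hermiteFn_mul i j)
    simp only [← integral_complex_ofReal, Complex.ofReal_mul] at this
    rw [this]; split_ifs <;> simp
  rw [← h]
  refine integral_congr_ae ?_
  filter_upwards [(memLp_hermiteFn i).coeFn_toLp, (memLp_hermiteFn j).coeFn_toLp] with ξ h1 h2
  rw [h1, h2, RCLike.inner_apply, Complex.conj_ofReal, mul_comm]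

theorem bessel_hermiteFn {f : ℝ → ℂ} (hf : MemLp f 2 volume) :
    Summable (fun j => ‖∫ ξ : ℝ, conj (f ξ) * (hermiteFn j ξ : ℂ)‖ ^ 2) ∧
      ∑' j, ‖∫ ξ : ℝ, conj (f ξ) * (hermiteFn j ξ : ℂ)‖ ^ 2 ≤ ∫ ξ : ℝ, ‖f ξ‖ ^ 2 := by
  have e : ∀ j, ‖∫ ξ : ℝ, conj (f ξ) * (hermiteFn j ξ : ℂ)‖ =
      ‖inner ℂ ((memLp_hermiteFn j).toLp _) (hf.toLp f)‖ := by
    intro j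
    rw [norm_inner_symm, L2.inner_def]
    congr 1
    refine integral_congr_ae ?_
    filter_upwards [(memLp_hermiteFn j).coeFn_toLp, hf.coeFn_toLp] with ξ h1 h2
    rw [h1, h2, RCLike.inner_apply, mul_comm]
  have hn : ‖hf.toLp f‖ ^ 2 = ∫ ξ : ℝ, ‖f ξ‖ ^ 2 := by
    have h : ((‖hf.toLp f‖ ^ 2 : ℝ) : ℂ) = ((∫ ξ : ℝ, ‖f ξ‖ ^ 2 : ℝ) : ℂ) := by
      rw [← integral_complex_ofReal, Complex.ofReal_pow]
      refine (inner_self_eq_norm_sq_to_K (𝕜 := ℂ) (hf.toLp f)).symm.trans ?_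
      rw [L2.inner_def]
      refine integral_congr_ae ?_
      filter_upwards [hf.coeFn_toLp] with ξ h
      rw [h, inner_self_eq_norm_sq_to_K]
      simp
    exact_mod_cast h
  simp only [e]
  exact ⟨orthonormal_hermiteFn.inner_products_summable _,
    (orthonormal_hermiteFn.tsum_inner_products_le _).trans_eq hn⟩

/-! ### Displaced oscillator states -/

/-- The displaced oscillator state `D(-α) φ_i`. -/
noncomputable def displacedState (α : ℂ) (i : ℕ) : ℝ → ℂ :=
  displacement (-α) (fun x => (hermiteFn i x : ℂ))

theorem displacedState_apply (α : ℂ) (i : ℕ) (ξ : ℝ) : displacedState α i ξ =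
    Complex.exp (Complex.I * ((-(√2 * α.im * ξ) - α.re * α.im : ℝ) : ℂ)) *
      (hermiteFn i (ξ + √2 * α.re) : ℂ) := by
  simp [displacedState, displacement]

theorem norm_displacedState (α : ℂ) (i : ℕ) (ξ : ℝ) :
    ‖displacedState α i ξ‖ = |hermiteFn i (ξ + √2 * α.re)| := by
  rw [displacedState_apply, norm_mul, mul_comm Complex.I, Complex.norm_exp_ofReal_mul_I, one_mul,
    Complex.norm_real, Real.norm_eq_abs]

theorem continuous_displacedState (α : ℂ) (i : ℕ) : Continuous (displacedState α i) := by
  simp only [funext (displacedState_apply α i)]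
  fun_prop

theorem continuous_displacedState_left (i : ℕ) (ξ : ℝ) :
    Continuous (fun α => displacedState α i ξ) := by
  simp only [displacedState_apply]
  fun_prop

/-- Uniformity over a ball of `α` is the point: the bound serves as a dominating function when `α`
varies. -/
theorem exists_norm_displacedState_le (i : ℕ) (R : ℝ) :
    ∃ C : ℝ, 0 ≤ C ∧ ∀ α : ℂ, ‖α‖ ≤ R → ∀ ξ,
      ‖displacedState α i ξ‖ ≤ C * Real.exp (-(1 / 8) * ξ ^ 2) := by
  obtain ⟨C, hC, h⟩ := exists_hermiteFn_le i
  refine ⟨C * Real.exp (R ^ 2), by positivity, fun α hα ξ => ?_⟩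
  rw [norm_displacedState, mul_assoc, ← Real.exp_add]
  refine (h _).trans (mul_le_mul_of_nonneg_left (Real.exp_le_exp.2 ?_) hC)
  have h2 : √2 * √2 = (2 : ℝ) := Real.mul_self_sqrt (by norm_num)
  have hr : α.re ^ 2 ≤ R ^ 2 :=
    sq_le_sq.2 ((Complex.abs_re_le_norm α).trans (hα.trans (le_abs_self R)))
  have hs : (√2 * α.re) ^ 2 = 2 * α.re ^ 2 := by rw [mul_pow, sq √2, h2]
  -- With `s = √2 Re α`, the square gives `-(ξ + s)² / 4 ≤ s² / 4 - ξ² / 8`, and `s² / 4 ≤ R² / 2`.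
  nlinarith [sq_nonneg (ξ + 2 * (√2 * α.re)), sq_nonneg R]

theorem memLp_displacedState (α : ℂ) (i : ℕ) : MemLp (displacedState α i) 2 volume := by
  obtain ⟨C, _, h⟩ := exists_norm_displacedState_le i ‖α‖
  exact memLp_two_of_norm_le_gaussian (continuous_displacedState α i) (by norm_num) (h α le_rfl)

theorem integral_norm_sq_displacedState (α : ℂ) (i : ℕ) :
    ∫ ξ : ℝ, ‖displacedState α i ξ‖ ^ 2 = 1 := by
  simp only [norm_displacedState, sq_abs]
  rw [integral_add_right_eq_self (fun ξ => hermiteFn i ξ ^ 2)]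
  simpa [sq] using integral_hermiteFn_mul i i

/-- Strong continuity of the displacement operators on a fixed oscillator state, by dominated
convergence on a unit ball around `β`. -/
theorem tendsto_integral_norm_sq_displacedState_sub (i : ℕ) (β : ℂ) :
    Tendsto (fun α => ∫ ξ : ℝ, ‖displacedState α i ξ - displacedState β i ξ‖ ^ 2) (𝓝 β)
      (𝓝 0) := by
  obtain ⟨C, hC, h⟩ := exists_norm_displacedState_le i (‖β‖ + 1)
  have h0 : ∫ ξ : ℝ, ‖displacedState β i ξ - displacedState β i ξ‖ ^ 2 = 0 := by simp
  rw [← h0]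
  refine tendsto_integral_filter_of_dominated_convergence
    (fun ξ => (2 * C) ^ 2 * Real.exp (-(1 / 4) * ξ ^ 2)) (Eventually.of_forall fun α => ?_) ?_
    ((integrable_exp_neg_mul_sq (by norm_num)).const_mul _) (Eventually.of_forall fun ξ => ?_)
  · have := continuous_displacedState α i
    have := continuous_displacedState β i
    exact Continuous.aestronglyMeasurable (by fun_prop)
  · have hev : ∀ᶠ α : ℂ in 𝓝 β, ‖α‖ ≤ ‖β‖ + 1 :=
      (continuous_norm.tendsto β).eventually (eventually_le_nhds (by linarith))
    filter_upwards [hev] with α hα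
    refine Eventually.of_forall fun ξ => ?_
    rw [Real.norm_of_nonneg (by positivity)]
    calc ‖displacedState α i ξ - displacedState β i ξ‖ ^ 2
        ≤ (2 * C * Real.exp (-(1 / 8) * ξ ^ 2)) ^ 2 := by
          gcongr
          refine (norm_sub_le _ _).trans ?_
          linarith [h α hα ξ, h β (by linarith) ξ]
      _ = (2 * C) ^ 2 * Real.exp (-(1 / 4) * ξ ^ 2) := by
          rw [mul_pow, ← Real.exp_nat_mul]; congr 2; push_cast; ring
  · have := continuous_displacedState_left i ξ
    exact Continuous.tendsto (f := fun α => ‖displacedState α i ξ - displacedState β i ξ‖ ^ 2)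
      (by fun_prop) β

/-! ### Matrix elements of the displacement operator -/

/-- Translating the variable by `√2 Re α` moves the displacement onto `φ_i`. The whole row in `j`
then comes from a single `L²` function, as Bessel's inequality requires. -/
theorem dispElem_eq_integral (α : ℂ) (i j : ℕ) :
    dispElem α i j = ∫ ξ : ℝ, conj (displacedState α i ξ) * (hermiteFn j ξ : ℂ) := by
  have h2 : √2 * √2 = (2 : ℝ) := Real.mul_self_sqrt (by norm_num)
  rw [dispElem, ← integral_add_right_eq_self _ (√2 * α.re)]
  congr 1 with ξ
  rw [displacedState_apply, displacement, map_mul, ← Complex.exp_conj, map_mul, Complex.conj_I,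
    Complex.conj_ofReal, Complex.conj_ofReal, add_sub_cancel_right]
  have : Complex.I * ((√2 * α.im * (ξ + √2 * α.re) - α.re * α.im : ℝ) : ℂ) =
      -Complex.I * ((-(√2 * α.im * ξ) - α.re * α.im : ℝ) : ℂ) := by
    rw [neg_mul, ← mul_neg, ← Complex.ofReal_neg]
    congr 2
    linear_combination α.im * α.re * h2
  rw [this]
  ring

theorem l2Bound_dispElem (α : ℂ) (i : ℕ) : L2Bound 1 (dispElem α i) := by
  obtain ⟨h1, h2⟩ := bessel_hermiteFn (memLp_displacedState α i)
  simp only [← dispElem_eq_integral] at h1 h2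
  refine ⟨h1, ?_⟩
  rw [Real.sqrt_le_left zero_le_one, one_pow]
  exact h2.trans_eq (integral_norm_sq_displacedState α i)

theorem bessel_dispElem_sub (α β : ℂ) (i : ℕ) :
    Summable (fun j => ‖dispElem α i j - dispElem β i j‖ ^ 2) ∧
      ∑' j, ‖dispElem α i j - dispElem β i j‖ ^ 2 ≤
        ∫ ξ : ℝ, ‖displacedState α i ξ - displacedState β i ξ‖ ^ 2 := by
  have h := bessel_hermiteFn ((memLp_displacedState α i).sub (memLp_displacedState β i))
  have e : ∀ j, ∫ ξ : ℝ, conj ((displacedState α i - displacedState β i) ξ) *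
      (hermiteFn j ξ : ℂ) = dispElem α i j - dispElem β i j := by
    intro j
    rw [dispElem_eq_integral, dispElem_eq_integral, ← integral_sub]
    · simp only [Pi.sub_apply, map_sub, sub_mul]
    · exact (memLp_displacedState α i).star.integrable_mul (memLp_hermiteFn j)
    · exact (memLp_displacedState β i).star.integrable_mul (memLp_hermiteFn j)
  simp only [e] at h
  exact h

theorem tendsto_tsum_norm_sq_dispElem_sub (i : ℕ) (β : ℂ) :
    Tendsto (fun α => ∑' j, ‖dispElem α i j - dispElem β i j‖ ^ 2) (𝓝 β) (𝓝 0) :=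
  squeeze_zero (fun _ => tsum_nonneg fun _ => by positivity)
    (fun α => (bessel_dispElem_sub α β i).2) (tendsto_integral_norm_sq_displacedState_sub i β)

theorem dispElem_zero_zero (α : ℂ) :
    dispElem α 0 0 = (Real.exp (-(α.re ^ 2 + α.im ^ 2) / 2) : ℂ) := by
  have h2 : ((√2 : ℝ) : ℂ) * ((√2 : ℝ) : ℂ) = 2 := by
    exact_mod_cast Real.mul_self_sqrt (show (0 : ℝ) ≤ 2 by norm_num)
  have hπ : ((Real.pi ^ (1 / 4 : ℝ))⁻¹ * (Real.pi ^ (1 / 4 : ℝ))⁻¹ : ℝ) * √Real.pi = 1 := by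
    have : Real.pi ^ (1 / 4 : ℝ) * Real.pi ^ (1 / 4 : ℝ) = √Real.pi := by
      rw [← Real.rpow_add Real.pi_pos, Real.sqrt_eq_rpow]; norm_num
    rw [← this]
    have := Real.rpow_pos_of_pos Real.pi_pos (1 / 4)
    field_simp
  -- The form `- -1` is what `integral_cexp_quadratic` produces for leading coefficient `-1`.
  have hs : (Real.pi / - -1 : ℂ) ^ (1 / 2 : ℂ) = ((√Real.pi : ℝ) : ℂ) := by
    rw [Real.sqrt_eq_rpow, Complex.ofReal_cpow Real.pi_pos.le]; norm_num
  have e : ∀ ξ : ℝ, conj (hermiteFn 0 ξ : ℂ) *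
      displacement α (fun x => (hermiteFn 0 x : ℂ)) ξ =
      (((Real.pi ^ (1 / 4 : ℝ))⁻¹ * (Real.pi ^ (1 / 4 : ℝ))⁻¹ : ℝ) : ℂ) *
        Complex.exp (-1 * (ξ : ℂ) ^ 2 + (√2 * α.re + √2 * α.im * Complex.I) * ξ +
          (-(α.re : ℂ) ^ 2 - α.re * α.im * Complex.I)) := by
    intro ξ
    simp only [hermiteFn_eq, displacement, realHermite_zero, Polynomial.eval_one,
      Nat.factorial_zero, Nat.cast_one, Real.sqrt_one, inv_one, mul_one, Complex.conj_ofReal]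
    have : Complex.exp (-1 * (ξ : ℂ) ^ 2 + (√2 * α.re + √2 * α.im * Complex.I) * ξ +
          (-(α.re : ℂ) ^ 2 - α.re * α.im * Complex.I)) =
        Complex.exp ((-ξ ^ 2 / 2 : ℝ) : ℂ) *
          (Complex.exp (Complex.I * ((√2 * α.im * ξ - α.re * α.im : ℝ) : ℂ)) *
            Complex.exp ((-(ξ - √2 * α.re) ^ 2 / 2 : ℝ) : ℂ)) := by
      rw [← Complex.exp_add, ← Complex.exp_add]
      congr 1
      push_cast
      linear_combination (α.re : ℂ) ^ 2 / 2 * h2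
    rw [this]
    push_cast
    ring
  rw [dispElem]
  simp only [e]
  rw [integral_const_mul, integral_cexp_quadratic (by simp), hs, ← mul_assoc,
    ← Complex.ofReal_mul, hπ, Complex.ofReal_one, one_mul, Complex.ofReal_exp]
  congr 1
  push_cast
  -- Completing the square contributes `α² / 2`; its cross term cancels the phase `-i Re α Im α`,
  -- leaving `-|α|² / 2`.
  linear_combination ((α.re + α.im * Complex.I) ^ 2 / 4 : ℂ) * h2 +
    (α.im : ℂ) ^ 2 / 2 * Complex.I_sq

/-! ### Square summable sequences -/

theorem L2Bound.nonneg {C : ℝ} {c : ℕ → ℂ} (h : L2Bound C c) : 0 ≤ C :=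
  (Real.sqrt_nonneg _).trans h.2

theorem summable_norm_mul_and_tsum_le {a b : ℕ → ℂ} (ha : Summable fun j => ‖a j‖ ^ 2)
    (hb : Summable fun j => ‖b j‖ ^ 2) :
    Summable (fun j => ‖a j‖ * ‖b j‖) ∧
      ∑' j, ‖a j‖ * ‖b j‖ ≤ √(∑' j, ‖a j‖ ^ 2) * √(∑' j, ‖b j‖ ^ 2) := by
  have h := Real.summable_and_inner_le_Lp_mul_Lq_tsum_of_nonneg Real.HolderConjugate.two_two
    (fun j => norm_nonneg (a j)) (fun j => norm_nonneg (b j))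
    (by simpa only [Real.rpow_two] using ha) (by simpa only [Real.rpow_two] using hb)
  simpa only [Real.rpow_two, ← Real.sqrt_eq_rpow] using h

theorem summable_mul_of_sq {a b : ℕ → ℂ} (ha : Summable fun j => ‖a j‖ ^ 2)
    (hb : Summable fun j => ‖b j‖ ^ 2) : Summable (fun j => a j * b j) :=
  Summable.of_norm (by simpa only [norm_mul] using (summable_norm_mul_and_tsum_le ha hb).1)

theorem norm_tsum_mul_le {a b : ℕ → ℂ} (ha : Summable fun j => ‖a j‖ ^ 2)
    (hb : Summable fun j => ‖b j‖ ^ 2) :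
    ‖∑' j, a j * b j‖ ≤ √(∑' j, ‖a j‖ ^ 2) * √(∑' j, ‖b j‖ ^ 2) := by
  obtain ⟨h1, h2⟩ := summable_norm_mul_and_tsum_le ha hb
  refine (norm_tsum_le_tsum_norm (by simpa only [norm_mul] using h1)).trans ?_
  simpa only [norm_mul] using h2

theorem L2Bound.tsum_mul_le {C D : ℝ} {a b : ℕ → ℂ} (ha : L2Bound C a) (hb : L2Bound D b) :
    ∑' j, ‖a j‖ * ‖b j‖ ≤ C * D :=
  (summable_norm_mul_and_tsum_le ha.1 hb.1).2.trans
    (mul_le_mul ha.2 hb.2 (Real.sqrt_nonneg _) ha.nonneg)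

/-- Fatou's lemma for series: each finite partial sum inherits the bound in the limit. -/
theorem L2Bound.of_tendsto {C : ℝ} {x : ℕ → ℕ → ℂ} {x₀ : ℕ → ℂ} (hx : ∀ ν, L2Bound C (x ν))
    (h : ∀ j, Tendsto (fun ν => x ν j) atTop (𝓝 (x₀ j))) : L2Bound C x₀ := by
  have hC := (hx 0).nonneg
  have hs : ∀ s : Finset ℕ, ∑ j ∈ s, ‖x₀ j‖ ^ 2 ≤ C ^ 2 := fun s =>
    le_of_tendsto (tendsto_finsetSum s fun j _ => ((h j).norm.pow 2))
      (Eventually.of_forall fun ν =>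
        ((hx ν).1.sum_le_tsum s fun _ _ => by positivity).trans
          ((Real.sqrt_le_left hC).1 (hx ν).2))
  have hsum : Summable fun j => ‖x₀ j‖ ^ 2 :=
    summable_of_sum_le (fun _ => by positivity) hs
  exact ⟨hsum, (Real.sqrt_le_left hC).2 (hsum.tsum_le_of_sum_le hs)⟩

/-- Bounded coordinatewise convergent sequences in `ℓ²` converge weakly. -/
theorem tendsto_tsum_mul_of_l2Bound {C : ℝ} {x : ℕ → ℕ → ℂ} {x₀ d : ℕ → ℂ}
    (hx : ∀ ν, L2Bound C (x ν)) (h : ∀ j, Tendsto (fun ν => x ν j) atTop (𝓝 (x₀ j)))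
    (hd : Summable fun j => ‖d j‖ ^ 2) :
    Tendsto (fun ν => ∑' j, x ν j * d j) atTop (𝓝 (∑' j, x₀ j * d j)) := by
  have hx₀ := L2Bound.of_tendsto hx h
  have htail : Tendsto (fun N => C * √(∑' j, ‖d (j + N)‖ ^ 2)) atTop (𝓝 0) := by
    have := (tendsto_sum_nat_add fun j => ‖d j‖ ^ 2).sqrt.const_mul C
    simpa using this
  -- By Cauchy–Schwarz the tail is controlled by the tail of `d` alone, uniformly in `ν`, so the
  -- limits in `N` and `ν` may be exchanged.
  have key : ∀ (y : ℕ → ℂ), L2Bound C y → ∀ N,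
      dist (∑ j ∈ Finset.range N, y j * d j) (∑' j, y j * d j) ≤
        C * √(∑' j, ‖d (j + N)‖ ^ 2) := by
    intro y hy N
    rw [← (summable_mul_of_sq hy.1 hd).sum_add_tsum_nat_add N, dist_self_add_right]
    refine (norm_tsum_mul_le (a := fun j => y (j + N)) (b := fun j => d (j + N))
      ((summable_nat_add_iff N).2 hy.1) ((summable_nat_add_iff N).2 hd)).trans ?_
    refine mul_le_mul_of_nonneg_right (le_trans (Real.sqrt_le_sqrt ?_) hy.2) (Real.sqrt_nonneg _)
    rw [← hy.1.sum_add_tsum_nat_add N]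
    exact le_add_of_nonneg_left (Finset.sum_nonneg fun _ _ => by positivity)
  have hunif : TendstoUniformly (fun N ν => ∑ j ∈ Finset.range N, x ν j * d j)
      (fun ν => ∑' j, x ν j * d j) atTop := by
    rw [Metric.tendstoUniformly_iff]
    intro ε hε
    filter_upwards [htail.eventually (gt_mem_nhds hε)] with N hN ν
    rw [dist_comm]
    exact (key _ (hx ν) N).trans_lt hN
  exact hunif.tendsto_of_eventually_tendsto
    (Eventually.of_forall fun N => tendsto_finsetSum _ fun j _ => (h j).mul_const (d j))
    (summable_mul_of_sq hx₀.1 hd).tendsto_sum_tsum_nat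

/-- The pairing of a bounded coordinatewise convergent sequence with a norm convergent one. -/
theorem tendsto_tsum_mul_of_l2Bound_of_tendsto {C : ℝ} {x d : ℕ → ℕ → ℂ} {x₀ d₀ : ℕ → ℂ}
    (hx : ∀ ν, L2Bound C (x ν)) (h : ∀ j, Tendsto (fun ν => x ν j) atTop (𝓝 (x₀ j)))
    (hd₀ : Summable fun j => ‖d₀ j‖ ^ 2) (hs : ∀ ν, Summable fun j => ‖d ν j - d₀ j‖ ^ 2)
    (hd : Tendsto (fun ν => ∑' j, ‖d ν j - d₀ j‖ ^ 2) atTop (𝓝 0)) :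
    Tendsto (fun ν => ∑' j, x ν j * d ν j) atTop (𝓝 (∑' j, x₀ j * d₀ j)) := by
  -- The first piece is at most `C` times the `ℓ²` distance of `d ν` from `d₀`; the second is weak
  -- convergence.
  have e : ∀ ν, ∑' j, x ν j * d ν j =
      ∑' j, x ν j * (d ν j - d₀ j) + ∑' j, x ν j * d₀ j := by
    intro ν
    rw [← (summable_mul_of_sq (hx ν).1 (hs ν)).tsum_add (summable_mul_of_sq (hx ν).1 hd₀)]
    congr 1 with j
    ring
  have h0 : Tendsto (fun ν => ∑' j, x ν j * (d ν j - d₀ j)) atTop (𝓝 0) := by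
    have hb : Tendsto (fun ν => C * √(∑' j, ‖d ν j - d₀ j‖ ^ 2)) atTop (𝓝 0) := by
      simpa using hd.sqrt.const_mul C
    refine squeeze_zero_norm (fun ν => ?_) hb
    exact (norm_tsum_mul_le (hx ν).1 (hs ν)).trans
      (mul_le_mul_of_nonneg_right (hx ν).2 (Real.sqrt_nonneg _))
  simp only [e]
  simpa using h0.add (tendsto_tsum_mul_of_l2Bound hx h hd₀)

/-! ### Sums over Fourier labels and oscillator levels -/

section Rows

variable {ι : Type*} {v : ι → ℂ}

theorem summable_row {C D : ℝ} {x d : ι → ℕ → ℂ} {w : ι → ℂ} (hv : Summable fun p => ‖v p‖)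
    (hw : ∀ p, ‖w p‖ ≤ 1) (hx : ∀ p, L2Bound C (x p)) (hd : ∀ p, L2Bound D (d p)) :
    Summable (fun q : ι × ℕ => v q.1 * x q.1 q.2 * w q.1 * d q.1 q.2) := by
  refine Summable.of_norm_bounded (g := fun q : ι × ℕ => ‖v q.1‖ * (‖x q.1 q.2‖ * ‖d q.1 q.2‖))
    ?_ fun q => ?_
  · have h0 : 0 ≤ fun q : ι × ℕ => ‖v q.1‖ * (‖x q.1 q.2‖ * ‖d q.1 q.2‖) :=
      fun q => mul_nonneg (norm_nonneg _) (mul_nonneg (norm_nonneg _) (norm_nonneg _))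
    have h1 : ∀ p, Summable fun j => ‖x p j‖ * ‖d p j‖ := fun p =>
      (summable_norm_mul_and_tsum_le (hx p).1 (hd p).1).1
    refine (summable_prod_of_nonneg h0).2 ⟨fun p => (h1 p).mul_left ‖v p‖, ?_⟩
    simp only [tsum_mul_left]
    exact Summable.of_nonneg_of_le
      (fun p => mul_nonneg (norm_nonneg _) (tsum_nonneg fun _ => by positivity))
      (fun p => mul_le_mul_of_nonneg_left ((hx p).tsum_mul_le (hd p)) (norm_nonneg _))
      (hv.mul_right (C * D))
  · rw [norm_mul, norm_mul, norm_mul]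
    calc ‖v q.1‖ * ‖x q.1 q.2‖ * ‖w q.1‖ * ‖d q.1 q.2‖
        ≤ ‖v q.1‖ * ‖x q.1 q.2‖ * 1 * ‖d q.1 q.2‖ := by gcongr; exact hw _
      _ = _ := by ring

/-- The `ℓ²` bounds give no summable majorant jointly in `p` and `j`. The sum over `j` is therefore
taken first, by weak–strong pairing, and only the sum over `p` uses domination, by `‖v p‖ * (C *
D)`. -/
theorem tendsto_tsum_row {C D : ℝ} {x d : ℕ → ι → ℕ → ℂ} {x₀ d₀ : ι → ℕ → ℂ} {w : ℕ → ι → ℂ}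
    {w₀ : ι → ℂ} (hv : Summable fun p => ‖v p‖)
    (hw : ∀ ν p, ‖w ν p‖ ≤ 1) (hw₀ : ∀ p, Tendsto (fun ν => w ν p) atTop (𝓝 (w₀ p)))
    (hx : ∀ ν p, L2Bound C (x ν p))
    (hx₀ : ∀ p j, Tendsto (fun ν => x ν p j) atTop (𝓝 (x₀ p j)))
    (hd : ∀ ν p, L2Bound D (d ν p)) (hd₀ : ∀ p, L2Bound D (d₀ p))
    (hs : ∀ ν p, Summable fun j => ‖d ν p j - d₀ p j‖ ^ 2)
    (hdd : ∀ p, Tendsto (fun ν => ∑' j, ‖d ν p j - d₀ p j‖ ^ 2) atTop (𝓝 0)) :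
    Tendsto (fun ν => ∑' q : ι × ℕ, v q.1 * x ν q.1 q.2 * w ν q.1 * d ν q.1 q.2) atTop
      (𝓝 (∑' q : ι × ℕ, v q.1 * x₀ q.1 q.2 * w₀ q.1 * d₀ q.1 q.2)) := by
  have hw₀' : ∀ p, ‖w₀ p‖ ≤ 1 := fun p =>
    le_of_tendsto (hw₀ p).norm (Eventually.of_forall fun ν => hw ν p)
  have hx₀' : ∀ p, L2Bound C (x₀ p) := fun p => L2Bound.of_tendsto (fun ν => hx ν p) (hx₀ p)
  have e : ∀ {x' d' : ι → ℕ → ℂ} {w' : ι → ℂ}, (∀ p, ‖w' p‖ ≤ 1) → (∀ p, L2Bound C (x' p)) →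
      (∀ p, L2Bound D (d' p)) →
      ∑' q : ι × ℕ, v q.1 * x' q.1 q.2 * w' q.1 * d' q.1 q.2 =
        ∑' p, v p * w' p * ∑' j, x' p j * d' p j := by
    intro x' d' w' hw' hx' hd'
    rw [(summable_row hv hw' hx' hd').tsum_prod]
    congr 1 with p
    rw [← tsum_mul_left]
    congr 1 with j
    ring
  simp only [e (hw _) (hx _) (hd _), e hw₀' hx₀' hd₀]
  refine tendsto_tsum_of_dominated_convergence (hv.mul_right (C * D)) (fun p => ?_)
    (Eventually.of_forall fun ν p => ?_)
  · exact ((hw₀ p).const_mul _).mul (tendsto_tsum_mul_of_l2Bound_of_tendsto (fun ν => hx ν p)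
      (hx₀ p) (hd₀ p).1 (fun ν => hs ν p) (hdd p))
  · rw [norm_mul, norm_mul]
    have h1 : ‖∑' j, x ν p j * d ν p j‖ ≤ C * D :=
      (norm_tsum_mul_le (hx ν p).1 (hd ν p).1).trans
        (mul_le_mul (hx ν p).2 (hd ν p).2 (Real.sqrt_nonneg _) (hx ν p).nonneg)
    calc ‖v p‖ * ‖w ν p‖ * ‖∑' j, x ν p j * d ν p j‖ ≤ ‖v p‖ * 1 * (C * D) := by
          gcongr
          exact hw ν p
      _ = ‖v p‖ * (C * D) := by ring

end Rows

/-! ### Limits of the parameters -/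

section Parameters

variable (P : Setting)

theorem ωc_pos : 0 < ωc P := div_pos (mul_pos P.e_pos P.B_pos) P.me_pos

theorem tendsto_id_nhdsWithin_zero : Tendsto (fun ωp : ℝ => ωp) (𝓝[>] 0) (𝓝 0) :=
  tendsto_nhdsWithin_of_tendsto_nhds tendsto_id

theorem tendsto_M : Tendsto (fun ωp => M P ωp) (𝓝[>] 0) atTop := by
  have h : Tendsto (fun ωp : ℝ => ωp ^ 2) (𝓝[>] 0) (𝓝[>] 0) := by
    refine tendsto_nhdsWithin_iff.2 ⟨?_, ?_⟩
    · simpa using tendsto_id_nhdsWithin_zero.pow 2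
    · filter_upwards [self_mem_nhdsWithin] with x hx
      exact pow_pos (Set.mem_Ioi.1 hx) 2
  have hm : Tendsto (fun ωp => mp P ωp) (𝓝[>] 0) atTop := by
    simp only [mp, div_eq_mul_inv]
    exact (tendsto_inv_nhdsGT_zero.comp h).const_mul_atTop P.me_pos
  exact (tendsto_atTop_add_const_right _ _ hm).atTop_div_const two_pos

/-- The ratio equals `2 ωc² / (ωc² + ωp²)`. It enters `μ`, `Gv` and `wCoord`. -/
theorem tendsto_mp_div_M : Tendsto (fun ωp => mp P ωp / M P ωp) (𝓝[>] 0) (𝓝 2) := by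
  have hc := ωc_pos P
  have hm := P.me_pos
  have h : Tendsto (fun ωp : ℝ => 2 * ωc P ^ 2 / (ωc P ^ 2 + ωp ^ 2)) (𝓝[>] 0) (𝓝 2) := by
    have : ContinuousAt (fun ωp : ℝ => 2 * ωc P ^ 2 / (ωc P ^ 2 + ωp ^ 2)) 0 :=
      ContinuousAt.div (by fun_prop) (by fun_prop) (by positivity)
    have h2 := this.tendsto.mono_left (nhdsWithin_le_nhds (s := Set.Ioi 0))
    convert h2 using 2
    simp only [ne_eq, OfNat.ofNat_ne_zero, not_false_eq_true, zero_pow, add_zero]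
    field_simp
  refine h.congr' ?_
  filter_upwards [self_mem_nhdsWithin] with x hx
  have hx : 0 < x := hx
  rw [M, mp, mc]
  field_simp

theorem tendsto_inv_M : Tendsto (fun ωp => (M P ωp)⁻¹) (𝓝[>] 0) (𝓝 0) :=
  tendsto_inv_atTop_zero.comp (tendsto_M P)

theorem tendsto_kinetic (kw : ℝ) (n m : ℤ) :
    Tendsto (fun ωp => kinetic P ωp kw n m) (𝓝[>] 0) (𝓝 0) := by
  have h := (tendsto_inv_M P).const_mul (P.hbar ^ 2 * (kw + Gw P m n) ^ 2 / 2)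
  rw [mul_zero] at h
  refine h.congr fun ωp => ?_
  rw [kinetic, div_mul_eq_div_div, div_eq_mul_inv _ (M P ωp)]

theorem tendsto_Ω : Tendsto (fun ωp => Ω P ωp) (𝓝[>] 0) (𝓝 (ωc P)) := by
  have h := ((tendsto_id_nhdsWithin_zero.pow 2).add_const (ωc P ^ 2)).sqrt
  simpa [Ω, Real.sqrt_sq (ωc_pos P).le] using h

theorem tendsto_μ_mul_Ω :
    Tendsto (fun ωp => μ P ωp * Ω P ωp) (𝓝[>] 0) (𝓝 (2 * P.me / ωc P)) := by
  have h := ((tendsto_mp_div_M P).mul_const (mc P)).mul (tendsto_Ω P)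
  have hc := (ωc_pos P).ne'
  have e : 2 * mc P * ωc P = 2 * P.me / ωc P := by rw [mc]; field_simp
  rw [e] at h
  refine h.congr fun ωp => ?_
  rw [μ]; ring

theorem tendsto_Gv (m n : ℝ) :
    Tendsto (fun ωp => Gv P ωp m n) (𝓝[>] 0) (𝓝 (√2 / ωc P * G P m n)) := by
  have h := (tendsto_mp_div_M P).mul_const (G P m n / (√2 * ωc P))
  have h2 : √2 * √2 = (2 : ℝ) := Real.mul_self_sqrt (by norm_num)
  have hc := (ωc_pos P).ne'
  have e : 2 * (G P m n / (√2 * ωc P)) = √2 / ωc P * G P m n := by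
    field_simp
    linear_combination -(G P m n) * h2
  rw [e] at h
  refine h.congr fun ωp => ?_
  rw [Gv, div_mul_div_comm]
  congr 1; ring

/-- The two square-root prefactors differ before the limit. They merge into `b` once the `√2` in `A`
and the `√2` in the limit of `Gv` are absorbed, which squaring verifies. -/
theorem tendsto_alphaMat (n m : ℤ) :
    Tendsto (fun ωp => alphaMat P ωp n m) (𝓝[>] 0) (𝓝 (betaMat P n m)) := by
  have hc := ωc_pos P
  have hm := P.me_pos
  have hh := P.hbar_pos
  have h2 : √2 * √2 = (2 : ℝ) := Real.mul_self_sqrt (by norm_num)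
  have h20 : (0 : ℝ) < √2 := by positivity
  have hl := tendsto_μ_mul_Ω P
  set b := √(P.hbar / (2 * P.me * ωc P)) with hb
  have hre : Tendsto (fun ωp => √(μ P ωp * Ω P ωp / (2 * P.hbar)) * A P 0 n) (𝓝[>] 0)
      (𝓝 (b * Gx P n)) := by
    have h := (hl.div_const (2 * P.hbar)).sqrt.mul_const (A P 0 n)
    convert h using 2
    rw [A, zero_add]
    have : b = √(2 * P.me / ωc P / (2 * P.hbar)) * (P.hbar / (√2 * P.me)) := by
      rw [hb, Real.sqrt_eq_iff_mul_self_eq (by positivity) (by positivity),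
        mul_mul_mul_comm, Real.mul_self_sqrt (by positivity)]
      field_simp
      linear_combination h2
    rw [this]; ring
  have him : Tendsto (fun ωp => √(P.hbar / (2 * μ P ωp * Ω P ωp)) * Gv P ωp m n) (𝓝[>] 0)
      (𝓝 (b * G P m n)) := by
    have h := ((tendsto_const_nhds (x := P.hbar)).div (hl.const_mul 2)
      (by positivity)).sqrt.mul (tendsto_Gv P m n)
    simp only [← mul_assoc] at h
    have : b = √(P.hbar / (2 * (2 * P.me / ωc P))) * (√2 / ωc P) := by
      rw [hb, Real.sqrt_eq_iff_mul_self_eq (by positivity) (by positivity),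
        mul_mul_mul_comm, Real.mul_self_sqrt (by positivity)]
      field_simp
      linear_combination -h2
    rw [← this] at h
    exact h
  have h := hre.ofReal.neg.sub (him.ofReal.const_mul Complex.I)
  have e : -((b * Gx P n : ℝ) : ℂ) - Complex.I * ((b * G P m n : ℝ) : ℂ) = betaMat P n m := by
    rw [betaMat, ← hb]; push_cast; ring
  rw [e] at h
  exact h

/-! ### Limits of the basis functions -/

/-- Continuity must be joint, since the oscillator width and the argument both move with `ωp`. -/
theorem continuousAt_oscFn (j : ℕ) {lam : ℝ} (h : 0 < lam) (s : ℝ) :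
    ContinuousAt (fun q : ℝ × ℝ => oscFn q.1 j q.2) (lam, s) := by
  simp only [oscFn]
  refine ContinuousAt.mul (ContinuousAt.rpow_const (by fun_prop) (Or.inl h.ne')) ?_
  fun_prop

theorem tendsto_uTilde (u : ℝ) : Tendsto (fun ωp => uTilde P ωp u) (𝓝[>] 0) (𝓝 0) := by
  have h := ((tendsto_id_nhdsWithin_zero.const_mul P.hbar).div_const P.me).sqrt.const_mul u
  simpa [uTilde] using h

/-- The photonic part dies with `uTilde`, the electronic part with `1 / M`. This removes `kw` and
`m` from the limiting basis function. -/
theorem tendsto_wCoord (u y : ℝ) : Tendsto (fun ωp => wCoord P ωp u y) (𝓝[>] 0) (𝓝 0) := by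
  have h := (((tendsto_mp_div_M P).mul (tendsto_uTilde P u)).add
    ((tendsto_inv_M P).mul_const (mc P * (ωc P * y)))).div_const √2
  simp only [mul_zero, zero_mul, add_zero, zero_div] at h
  refine h.congr fun ωp => ?_
  rw [wCoord]; ring

theorem tendsto_vCoord (u y : ℝ) :
    Tendsto (fun ωp => vCoord P ωp u y) (𝓝[>] 0) (𝓝 (-(ωc P * y) / √2)) := by
  have h := ((tendsto_uTilde P u).sub_const (ωc P * y)).div_const √2
  rwa [zero_sub] at h

theorem tendsto_qedBasis (kx kw : ℝ) (n m : ℤ) (j : ℕ) (x y u : ℝ) :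
    Tendsto (fun ωp => qedBasis P ωp kx kw n m j x y u) (𝓝[>] 0)
      (𝓝 (llbBasis P kx n j x y)) := by
  have h1 := ((((tendsto_wCoord P u y).const_mul (kw + Gw P m n)).const_add
    ((kx + Gx P n) * x)).ofReal.const_mul Complex.I).cexp
  rw [mul_zero, add_zero] at h1
  have hlam : 0 < 2 * P.me / (P.hbar * ωc P) :=
    div_pos (mul_pos two_pos P.me_pos) (mul_pos P.hbar_pos (ωc_pos P))
  have hl := (tendsto_μ_mul_Ω P).div_const P.hbar
  rw [div_div, mul_comm (ωc P)] at hl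
  exact h1.mul ((continuousAt_oscFn j hlam _).tendsto.comp
    (hl.prodMk_nhds ((tendsto_vCoord P u y).sub_const (A P kx n)))).ofReal

end Parameters

/-! ### The central equations for absolutely summable potentials -/

section CentralEquations

variable (P : Setting) {V : ℤ → ℤ → ℂ}

/-- The limit, as `ωp → 0`, of the summand of the potential term in row `(n, m, i)`, for
coefficients `W` that may still depend on the label `m`. -/
noncomputable def limitTerm (V : ℤ → ℤ → ℂ) (kx : ℝ) (W : ℤ → ℤ → ℕ → ℂ) (n m : ℤ) (i : ℕ)
    (q : ℤ × ℤ × ℕ) : ℂ :=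
  V (n - q.1) (m - q.2.1) * W q.1 q.2.1 q.2.2 *
    Complex.exp (-Complex.I *
      ((P.hbar * (kx + 1 / 2 * Gx P ((n + q.1 : ℤ) : ℝ)) *
        G P ((m - q.2.1 : ℤ) : ℝ) ((n - q.1 : ℤ) : ℝ) / (P.me * ωc P) : ℝ) : ℂ)) *
    dispElem (betaMat P (n - q.1) (m - q.2.1)) i q.2.2

theorem norm_cexp_neg_I_mul_ofReal (r : ℝ) : ‖Complex.exp (-Complex.I * (r : ℂ))‖ = 1 := by
  rw [neg_mul, ← mul_neg, ← Complex.ofReal_neg, mul_comm, Complex.norm_exp_ofReal_mul_I]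

theorem summable_norm_potential_sub (hV : Summable fun p : ℤ × ℤ => ‖V p.1 p.2‖) (n m : ℤ) :
    Summable fun p : ℤ × ℤ => ‖V (n - p.1) (m - p.2)‖ :=
  ((Equiv.subLeft n).prodCongr (Equiv.subLeft m)).summable_iff.2 hV

theorem summable_norm_potential_sub_left (hV : Summable fun p : ℤ × ℤ => ‖V p.1 p.2‖) (n : ℤ) :
    Summable fun p : ℤ × ℤ => ‖V (n - p.1) p.2‖ :=
  ((Equiv.subLeft n).prodCongr (Equiv.refl ℤ)).summable_iff.2 hV

theorem summable_qedTerm (hV : Summable fun p : ℤ × ℤ => ‖V p.1 p.2‖) (ωp kx : ℝ)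
    {U : ℤ → ℤ → ℕ → ℂ} {C : ℝ} (hU : ∀ n m, L2Bound C (U n m)) (n m : ℤ) (i : ℕ) :
    Summable (qedTerm P V ωp kx U n m i) :=
  (Equiv.prodAssoc ℤ ℤ ℕ).summable_iff.1
    (summable_row (v := fun p : ℤ × ℤ => V (n - p.1) (m - p.2)) (x := fun p => U p.1 p.2)
      (w := fun p => Complex.exp (-Complex.I *
        ((Gv P ωp ((m - p.2 : ℤ) : ℝ) ((n - p.1 : ℤ) : ℝ) * A P kx (((n : ℝ) + p.1) / 2) : ℝ) : ℂ)))
      (d := fun p => dispElem (alphaMat P ωp (n - p.1) (m - p.2)) i)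
      (summable_norm_potential_sub hV n m) (fun _ => (norm_cexp_neg_I_mul_ofReal _).le)
      (fun p => hU p.1 p.2) (fun _ => l2Bound_dispElem _ i))

theorem summable_llbTerm (hV : Summable fun p : ℤ × ℤ => ‖V p.1 p.2‖) (kx : ℝ)
    {U : ℤ → ℕ → ℂ} {C : ℝ} (hU : ∀ n, L2Bound C (U n)) (n : ℤ) (i : ℕ) :
    Summable (llbTerm P V kx U n i) :=
  (Equiv.prodAssoc ℤ ℤ ℕ).summable_iff.1
    (summable_row (v := fun p : ℤ × ℤ => V (n - p.1) p.2) (x := fun p => U p.1)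
      (w := fun p => Complex.exp (-Complex.I *
        ((P.hbar * (kx + 1 / 2 * Gx P ((n + p.1 : ℤ) : ℝ)) *
          G P (p.2 : ℝ) ((n - p.1 : ℤ) : ℝ) / (P.me * ωc P) : ℝ) : ℂ)))
      (d := fun p => dispElem (betaMat P (n - p.1) p.2) i)
      (summable_norm_potential_sub_left hV n) (fun _ => (norm_cexp_neg_I_mul_ofReal _).le)
      (fun p => hU p.1) (fun _ => l2Bound_dispElem _ i))

/-- The `√2` from the limit of `Gv` cancels the one in `A`, and linearity of `Gx` turns the half-sum
index into the factor `1 / 2`. -/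
theorem tendsto_Gv_mul_A (kx : ℝ) (n n' l : ℤ) :
    Tendsto (fun ωp => Gv P ωp (l : ℝ) ((n - n' : ℤ) : ℝ) * A P kx (((n : ℝ) + n') / 2)) (𝓝[>] 0)
      (𝓝 (P.hbar * (kx + 1 / 2 * Gx P ((n + n' : ℤ) : ℝ)) * G P (l : ℝ) ((n - n' : ℤ) : ℝ) /
        (P.me * ωc P))) := by
  have h := (tendsto_Gv P (l : ℝ) ((n - n' : ℤ) : ℝ)).mul_const (A P kx (((n : ℝ) + n') / 2))
  convert h using 2
  have hc := (ωc_pos P).ne'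
  have hm := P.me_pos.ne'
  have ha := P.a₁_pos.ne'
  have h20 : √2 ≠ 0 := by positivity
  rw [A, Gx, Gx]
  push_cast
  field_simp

/-- The limit `W` may depend on `m`, so that one statement serves both the `m`-independent and the
summed case. -/
theorem tendsto_qedLHS (hV : Summable fun p : ℤ × ℤ => ‖V p.1 p.2‖) (kx kw : ℝ) {ωp : ℕ → ℝ}
    (hω : Tendsto ωp atTop (𝓝[>] 0)) {U : ℕ → ℤ → ℤ → ℕ → ℂ} {C : ℝ}
    (hU : ∀ ν n m, L2Bound C (U ν n m)) {E : ℕ → ℝ} {E₀ : ℝ} (hE : Tendsto E atTop (𝓝 E₀))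
    {W : ℤ → ℤ → ℕ → ℂ} (hW : ∀ n m j, Tendsto (fun ν => U ν n m j) atTop (𝓝 (W n m j)))
    (n m : ℤ) (i : ℕ) :
    Tendsto (fun ν => qedLHS P V (ωp ν) kx kw (U ν) (E ν) n m i) atTop
      (𝓝 (W n m i * ((P.hbar * ωc P * ((i : ℝ) + 1 / 2) - E₀ : ℝ) : ℂ) +
        ∑' q : ℤ × ℤ × ℕ, limitTerm P V kx W n m i q)) := by
  refine Tendsto.add ((hW n m i).mul (Tendsto.ofReal ?_)) ?_
  · have h := ((((tendsto_kinetic P kw n m).comp hω).add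
      ((((tendsto_Ω P).comp hω).const_mul P.hbar).mul_const ((i : ℝ) + 1 / 2))).sub hE)
    rwa [zero_add] at h
  · have e1 : ∀ ν, ∑' q : ℤ × ℤ × ℕ, qedTerm P V (ωp ν) kx (U ν) n m i q = _ := fun ν =>
      ((Equiv.prodAssoc ℤ ℤ ℕ).tsum_eq (qedTerm P V (ωp ν) kx (U ν) n m i)).symm
    simp only [e1]
    rw [← (Equiv.prodAssoc ℤ ℤ ℕ).tsum_eq (limitTerm P V kx W n m i)]
    exact tendsto_tsum_row (ι := ℤ × ℤ) (v := fun p => V (n - p.1) (m - p.2))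
      (x := fun ν p => U ν p.1 p.2) (x₀ := fun p => W p.1 p.2)
      (w := fun ν p => Complex.exp (-Complex.I *
        ((Gv P (ωp ν) ((m - p.2 : ℤ) : ℝ) ((n - p.1 : ℤ) : ℝ) *
          A P kx (((n : ℝ) + p.1) / 2) : ℝ) : ℂ)))
      (w₀ := fun p => Complex.exp (-Complex.I *
        ((P.hbar * (kx + 1 / 2 * Gx P ((n + p.1 : ℤ) : ℝ)) *
          G P ((m - p.2 : ℤ) : ℝ) ((n - p.1 : ℤ) : ℝ) / (P.me * ωc P) : ℝ) : ℂ)))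
      (d := fun ν p => dispElem (alphaMat P (ωp ν) (n - p.1) (m - p.2)) i)
      (d₀ := fun p => dispElem (betaMat P (n - p.1) (m - p.2)) i)
      (summable_norm_potential_sub hV n m) (fun _ _ => (norm_cexp_neg_I_mul_ofReal _).le)
      (fun p => (((tendsto_Gv_mul_A P kx n p.1 (m - p.2)).comp hω).ofReal.const_mul _).cexp)
      (fun ν p => hU ν p.1 p.2) (fun p j => hW p.1 p.2 j) (fun _ _ => l2Bound_dispElem _ i)
      (fun _ => l2Bound_dispElem _ i) (fun _ _ => (bessel_dispElem_sub _ _ i).1)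
      (fun p => (tendsto_tsum_norm_sq_dispElem_sub i _).comp
        ((tendsto_alphaMat P (n - p.1) (m - p.2)).comp hω))

/-- Reflection `m' ↦ m - m'` of the middle label. -/
def reflectMid (m : ℤ) : ℤ × ℤ × ℕ ≃ ℤ × ℤ × ℕ :=
  (Equiv.refl ℤ).prodCongr ((Equiv.subLeft m).prodCongr (Equiv.refl ℕ))

theorem reflectMid_apply (m : ℤ) (q : ℤ × ℤ × ℕ) : reflectMid m q = (q.1, m - q.2.1, q.2.2) := rfl

theorem limitTerm_reflectMid (V : ℤ → ℤ → ℂ) (kx : ℝ) (W : ℤ → ℤ → ℕ → ℂ) (n m : ℤ) (i : ℕ)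
    (q : ℤ × ℤ × ℕ) : limitTerm P V kx W n m i (reflectMid m q) =
      llbTerm P V kx (fun n' j => W n' (m - q.2.1) j) n i q := by
  simp only [limitTerm, llbTerm, reflectMid_apply, sub_sub_cancel]

theorem tsum_limitTerm (V : ℤ → ℤ → ℂ) (kx : ℝ) (U : ℤ → ℕ → ℂ) (n m : ℤ) (i : ℕ) :
    ∑' q, limitTerm P V kx (fun n' _ j => U n' j) n m i q = ∑' q, llbTerm P V kx U n i q := by
  rw [← (reflectMid m).tsum_eq]
  simp only [limitTerm_reflectMid]

/-- The input for Fubini. Cauchy–Schwarz handles `j`, with row norm at most 1; translation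
invariance bounds the sum over `m` by `K`; `V` then handles the Fourier labels. -/
theorem summable_norm_shifted_llbTerm (hV : Summable fun p : ℤ × ℤ => ‖V p.1 p.2‖) (kx : ℝ)
    {W : ℤ → ℤ → ℕ → ℂ} {K : ℝ} (hW2 : ∀ n m, Summable fun j => ‖W n m j‖ ^ 2)
    (hW : ∀ n, Summable (fun m => √(∑' j, ‖W n m j‖ ^ 2)) ∧
      ∑' m, √(∑' j, ‖W n m j‖ ^ 2) ≤ K) (n : ℤ) (i : ℕ) :
    Summable fun r : ℤ × ℤ × ℤ × ℕ =>
      ‖llbTerm P V kx (fun n' j => W n' (r.1 - r.2.2.1) j) n i r.2‖ := by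
  have hd := fun p : ℤ × ℤ => l2Bound_dispElem (betaMat P (n - p.1) p.2) i
  have h1 : Summable fun s : (ℤ × ℤ) × ℤ =>
      ‖V (n - s.1.1) s.1.2‖ * √(∑' j, ‖W s.1.1 (s.2 - s.1.2) j‖ ^ 2) := by
    have h0 : 0 ≤ fun s : (ℤ × ℤ) × ℤ =>
        ‖V (n - s.1.1) s.1.2‖ * √(∑' j, ‖W s.1.1 (s.2 - s.1.2) j‖ ^ 2) := fun _ =>
      mul_nonneg (norm_nonneg _) (Real.sqrt_nonneg _)
    have hsh : ∀ p : ℤ × ℤ, Summable fun m => √(∑' j, ‖W p.1 (m - p.2) j‖ ^ 2) := fun p =>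
      (Equiv.subRight p.2).summable_iff.2 (hW p.1).1
    refine (summable_prod_of_nonneg h0).2 ⟨fun p => (hsh p).mul_left ‖V (n - p.1) p.2‖, ?_⟩
    simp only [tsum_mul_left]
    refine Summable.of_nonneg_of_le
      (fun p => mul_nonneg (norm_nonneg _) (tsum_nonneg fun _ => Real.sqrt_nonneg _))
      (fun p => mul_le_mul_of_nonneg_left ?_ (norm_nonneg _))
      ((summable_norm_potential_sub_left hV n).mul_right K)
    exact ((Equiv.subRight p.2).tsum_eq fun m => √(∑' j, ‖W p.1 m j‖ ^ 2)).trans_le (hW p.1).2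
  have hcs := fun s : (ℤ × ℤ) × ℤ =>
    summable_norm_mul_and_tsum_le (hW2 s.1.1 (s.2 - s.1.2)) (hd s.1).1
  have h2 : Summable fun s : ((ℤ × ℤ) × ℤ) × ℕ => ‖V (n - s.1.1.1) s.1.1.2‖ *
      (‖W s.1.1.1 (s.1.2 - s.1.1.2) s.2‖ *
        ‖dispElem (betaMat P (n - s.1.1.1) s.1.1.2) i s.2‖) := by
    have h0 : 0 ≤ fun s : ((ℤ × ℤ) × ℤ) × ℕ => ‖V (n - s.1.1.1) s.1.1.2‖ *
      (‖W s.1.1.1 (s.1.2 - s.1.1.2) s.2‖ *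
        ‖dispElem (betaMat P (n - s.1.1.1) s.1.1.2) i s.2‖) := fun _ =>
      mul_nonneg (norm_nonneg _) (mul_nonneg (norm_nonneg _) (norm_nonneg _))
    refine (summable_prod_of_nonneg h0).2
      ⟨fun s => (hcs s).1.mul_left ‖V (n - s.1.1) s.1.2‖, ?_⟩
    simp only [tsum_mul_left]
    refine Summable.of_nonneg_of_le
      (fun s => mul_nonneg (norm_nonneg _)
        (tsum_nonneg fun _ => mul_nonneg (norm_nonneg _) (norm_nonneg _)))
      (fun s => mul_le_mul_of_nonneg_left ?_ (norm_nonneg _)) h1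
    exact (hcs s).2.trans (mul_le_of_le_one_right (Real.sqrt_nonneg _) (hd s.1).2)
  let e : ℤ × ℤ × ℤ × ℕ ≃ ((ℤ × ℤ) × ℤ) × ℕ :=
    { toFun := fun r => (((r.2.1, r.2.2.1), r.1), r.2.2.2)
      invFun := fun s => (s.1.2, s.1.1.1, s.1.1.2, s.2)
      left_inv := fun _ => rfl
      right_inv := fun _ => rfl }
  refine (e.summable_iff.2 h2).congr fun r => ?_
  simp only [llbTerm, norm_mul, norm_cexp_neg_I_mul_ofReal, one_mul, Function.comp_apply, e,
    Equiv.coe_fn_mk, mul_assoc]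

theorem tsum_shifted_llbTerm (V : ℤ → ℤ → ℂ) (kx : ℝ) (W : ℤ → ℤ → ℕ → ℂ) (n : ℤ) (i : ℕ)
    (q : ℤ × ℤ × ℕ) :
    ∑' m, llbTerm P V kx (fun n' j => W n' (m - q.2.1) j) n i q =
      llbTerm P V kx (fun n' j => ∑' m, W n' m j) n i q := by
  have h := (Equiv.subRight q.2.1).tsum_eq fun m => W q.1 m q.2.2
  simp only [Equiv.subRight_apply] at h
  simp only [llbTerm, tsum_mul_left, tsum_mul_right, h]

/-- The limiting rows are added over `m`. After exchanging sums, the shift by `m'` is invisible to a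
sum over all of `ℤ`. -/
theorem llbRow_of_summed_labels (hV : Summable fun p : ℤ × ℤ => ‖V p.1 p.2‖) (kx E : ℝ)
    {W : ℤ → ℤ → ℕ → ℂ} {K : ℝ} (hW2 : ∀ n m, Summable fun j => ‖W n m j‖ ^ 2)
    (hW : ∀ n, Summable (fun m => √(∑' j, ‖W n m j‖ ^ 2)) ∧
      ∑' m, √(∑' j, ‖W n m j‖ ^ 2) ≤ K) {n : ℤ} {i : ℕ}
    (h : ∀ m, W n m i * ((P.hbar * ωc P * ((i : ℝ) + 1 / 2) - E : ℝ) : ℂ) +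
      ∑' q, limitTerm P V kx W n m i q = 0) :
    LLBRow P V kx (fun n j => ∑' m, W n m j) E n i := by
  have hs : Summable fun r : ℤ × ℤ × ℤ × ℕ =>
      llbTerm P V kx (fun n' j => W n' (r.1 - r.2.2.1) j) n i r.2 :=
    (summable_norm_shifted_llbTerm P hV kx hW2 hW n i).of_norm
  have hWs : Summable fun m => W n m i :=
    Summable.of_norm_bounded (hW n).1 fun m =>
      Real.le_sqrt_of_sq_le ((hW2 n m).le_tsum i fun _ _ => by positivity)
  refine ⟨?_, ?_⟩
  · have := (hs.prod_symm).prod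
    exact this.congr (tsum_shifted_llbTerm P V kx W n i)
  · have h0 : ∑' m, (W n m i * ((P.hbar * ωc P * ((i : ℝ) + 1 / 2) - E : ℝ) : ℂ) +
      ∑' q, llbTerm P V kx (fun n' j => W n' (m - q.2.1) j) n i q) = 0 := by
      rw [← tsum_zero (β := ℤ) (α := ℂ)]
      congr 1 with m
      rw [← h m, ← (reflectMid m).tsum_eq (limitTerm P V kx W n m i)]
      simp only [limitTerm_reflectMid]
    rw [(hWs.mul_right _).tsum_add hs.prod, tsum_mul_right] at h0
    rw [llbLHS, ← h0]
    congr 1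
    exact (tsum_congr fun q => (tsum_shifted_llbTerm P V kx W n i q).symm).trans
      (Summable.tsum_comm hs)

end CentralEquations

/-! ### Harper's equation in the lowest Landau level -/

section LowestLandauLevel

variable (P : Setting)

/-- The labels of the four non-vanishing terms of row `(n, 0)` for the square cosine potential. -/
def cosineSupport (n : ℤ) : Finset (ℤ × ℤ × ℕ) :=
  {(n - 1, 0, 0), (n + 1, 0, 0), (n, 1, 0), (n, -1, 0)}

theorem llbTerm_cosine_eq_zero (V₀ kx : ℝ) (u : ℤ → ℂ) (n : ℤ) (i : ℕ) (q : ℤ × ℤ × ℕ)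
    (hq : q ∉ cosineSupport n) :
    llbTerm P (cosinePotential V₀) kx (lowestLevel u) n i q = 0 := by
  obtain ⟨n', m, j⟩ := q
  rw [llbTerm]
  by_cases hj : j = 0
  · have : cosinePotential V₀ (n - n') m = 0 := by
      rw [cosinePotential, if_neg]
      intro h
      apply hq
      simp only [cosineSupport, Finset.mem_insert, Finset.mem_singleton, Prod.mk.injEq]
      omega
    simp [this]
  · simp [lowestLevel, hj]

theorem tsum_llbTerm_cosine (V₀ kx : ℝ) (u : ℤ → ℂ) (n : ℤ) (i : ℕ) :
    ∑' q, llbTerm P (cosinePotential V₀) kx (lowestLevel u) n i q =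
      llbTerm P (cosinePotential V₀) kx (lowestLevel u) n i (n - 1, 0, 0) +
      llbTerm P (cosinePotential V₀) kx (lowestLevel u) n i (n + 1, 0, 0) +
      llbTerm P (cosinePotential V₀) kx (lowestLevel u) n i (n, 1, 0) +
      llbTerm P (cosinePotential V₀) kx (lowestLevel u) n i (n, -1, 0) := by
  rw [tsum_eq_sum (s := cosineSupport n) fun q hq => llbTerm_cosine_eq_zero P V₀ kx u n i q hq,
    cosineSupport, Finset.sum_insert, Finset.sum_insert, Finset.sum_insert, Finset.sum_singleton]
  · ring
  all_goals
    simp only [Finset.mem_insert, Finset.mem_singleton, Prod.mk.injEq]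
    omega

theorem dispElem_betaMat_zero_zero (n m : ℤ) : dispElem (betaMat P n m) 0 0 =
    (Real.exp (-(P.hbar / (2 * P.me * ωc P) * (Gx P n ^ 2 + G P m n ^ 2)) / 2) : ℂ) := by
  have h0 : 0 ≤ P.hbar / (2 * P.me * ωc P) :=
    (div_pos P.hbar_pos (mul_pos (mul_pos two_pos P.me_pos) (ωc_pos P))).le
  rw [dispElem_zero_zero]
  have hre : (betaMat P n m).re = -(√(P.hbar / (2 * P.me * ωc P)) * Gx P n) := by
    simp [betaMat]
  have him : (betaMat P n m).im = -(√(P.hbar / (2 * P.me * ωc P)) * G P m n) := by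
    simp [betaMat]
  rw [hre, him, neg_sq, neg_sq, mul_pow, mul_pow, Real.sq_sqrt h0, mul_add]

variable {P}

/-- On the square lattice all four displacements have equal modulus, so one Gaussian factor becomes
`hopping`. The terms `n' = n ± 1` have `G = 0` and no phase; the terms `n' = n` have phases `exp (∓
i θ)`. -/
theorem llbLHS_cosine (ha : P.a₁ = P.a₂) (hθ : P.θ = Real.pi / 2) (V₀ kx E : ℝ) (u : ℤ → ℂ)
    (n : ℤ) : llbLHS P (cosinePotential V₀) kx (lowestLevel u) E n 0 =
      (hopping P V₀ : ℂ) * (u (n - 1) + u (n + 1) + 2 * u n *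
        (Real.cos (2 * Real.pi * (Φ₀ P / Φ P) * (P.a₁ * kx / (2 * Real.pi) + n)) : ℂ)) -
      ((E - P.hbar * ωc P / 2 : ℝ) : ℂ) * u n := by
  have hcos : Real.cos P.θ = 0 := by rw [hθ, Real.cos_pi_div_two]
  have hsin : Real.sin P.θ = 1 := by rw [hθ, Real.sin_pi_div_two]
  have hG : ∀ m n : ℝ, G P m n = Gx P m := by
    intro m n; simp [G, hcos, hsin, Gy, Gx, ha]
  have hpi := Real.pi_pos
  have ha0 := P.a₁_pos
  have hB := P.B_pos
  have he := P.e_pos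
  have hh := P.hbar_pos
  have hme := P.me_pos
  have hexp : -(P.hbar / (2 * P.me * ωc P) * Gx P 1 ^ 2) / 2 =
      -(Real.pi * Φ₀ P) / (2 * Φ P) := by
    rw [Φ₀, Φ, ωc, Gx, ← ha, hsin]
    field_simp
  have hG0 : Gx P 0 = 0 := by simp [Gx]
  have hGneg : Gx P (-1) = -Gx P 1 := by simp [Gx]; ring
  set θ := 2 * Real.pi * (Φ₀ P / Φ P) * (P.a₁ * kx / (2 * Real.pi) + n) with hθdef
  have hph : P.hbar * (kx + 1 / 2 * Gx P ((n + n : ℤ) : ℝ)) * Gx P 1 / (P.me * ωc P) = θ := by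
    rw [hθdef, Φ₀, Φ, ωc, Gx, Gx, ← ha, hsin]
    push_cast
    field_simp
    ring
  have t1 : llbTerm P (cosinePotential V₀) kx (lowestLevel u) n 0 (n - 1, 0, 0) =
      (hopping P V₀ : ℂ) * u (n - 1) := by
    simp only [llbTerm, dispElem_betaMat_zero_zero, hG, lowestLevel, cosinePotential,
      sub_sub_cancel, Int.cast_zero, Int.cast_one, hG0]
    simp [hopping, ← hexp]
    ring
  have t2 : llbTerm P (cosinePotential V₀) kx (lowestLevel u) n 0 (n + 1, 0, 0) =
      (hopping P V₀ : ℂ) * u (n + 1) := by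
    simp only [llbTerm, dispElem_betaMat_zero_zero, hG, lowestLevel, cosinePotential,
      sub_add_cancel_left, Int.cast_zero, Int.cast_one, Int.cast_neg, hG0, hGneg]
    simp [hopping, ← hexp]
    ring
  have t3 : llbTerm P (cosinePotential V₀) kx (lowestLevel u) n 0 (n, 1, 0) =
      (hopping P V₀ : ℂ) * u n * Complex.exp (-θ * Complex.I) := by
    simp only [llbTerm, dispElem_betaMat_zero_zero, hG, lowestLevel, cosinePotential,
      sub_self, Int.cast_zero, Int.cast_one, hG0, hph]
    simp [hopping, ← hexp, mul_comm Complex.I]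
    ring
  have t4 : llbTerm P (cosinePotential V₀) kx (lowestLevel u) n 0 (n, -1, 0) =
      (hopping P V₀ : ℂ) * u n * Complex.exp (θ * Complex.I) := by
    simp only [llbTerm, dispElem_betaMat_zero_zero, hG, lowestLevel, cosinePotential,
      sub_self, Int.cast_zero, Int.cast_one, Int.cast_neg, hG0, hGneg, mul_neg, neg_div, hph]
    simp [hopping, ← hexp, mul_comm Complex.I]
    ring_nf
  rw [llbLHS, tsum_llbTerm_cosine, t1, t2, t3, t4, Complex.ofReal_cos, Complex.cos]
  simp only [lowestLevel, if_true]
  push_cast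
  ring

theorem forall_llbRow_cosine_iff_harper (ha : P.a₁ = P.a₂) (hθ : P.θ = Real.pi / 2) {V₀ : ℝ}
    (hV₀ : V₀ ≠ 0) (kx E : ℝ) (u : ℤ → ℂ) :
    (∀ n, LLBRow P (cosinePotential V₀) kx (lowestLevel u) E n 0) ↔
      Harper (Φ₀ P / Φ P) (P.a₁ * kx / (2 * Real.pi))
        ((E - P.hbar * ωc P / 2) / hopping P V₀) u := by
  have ht : (hopping P V₀ : ℂ) ≠ 0 := by
    rw [hopping]
    exact_mod_cast mul_ne_zero hV₀ (Real.exp_pos _).ne'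
  refine forall_congr' fun n => ?_
  have hs : Summable (llbTerm P (cosinePotential V₀) kx (lowestLevel u) n 0) :=
    summable_of_ne_finset_zero (s := cosineSupport n) fun q hq =>
      llbTerm_cosine_eq_zero P V₀ kx u n 0 q hq
  rw [LLBRow, and_iff_right hs, llbLHS_cosine ha hθ, sub_eq_zero, Complex.ofReal_div,
    div_mul_eq_mul_div, div_eq_iff ht, eq_comm, mul_comm (hopping P V₀ : ℂ)]

end LowestLandauLevel

end QEDBloch

theorem mainTheorem9 (P : Setting) :
    -- limits of the parameters
    (Tendsto (fun ωp => M P ωp) (𝓝[>] 0) atTop ∧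
      (∀ (kw : ℝ) (n m : ℤ), Tendsto (fun ωp => kinetic P ωp kw n m) (𝓝[>] 0) (𝓝 0)) ∧
      Tendsto (fun ωp => Ω P ωp) (𝓝[>] 0) (𝓝 (ωc P)) ∧
      Tendsto (fun ωp => μ P ωp * Ω P ωp) (𝓝[>] 0) (𝓝 (2 * P.me / ωc P)) ∧
      (∀ n m : ℤ, Tendsto (fun ωp => Gv P ωp m n) (𝓝[>] 0) (𝓝 (√2 / ωc P * G P m n))) ∧
      (∀ n m : ℤ, Tendsto (fun ωp => alphaMat P ωp n m) (𝓝[>] 0) (𝓝 (betaMat P n m)))) ∧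
    -- the QED-Bloch basis functions become Bloch waves times Landau levels; `kw`, `m`, `u` drop out
    (∀ (kx kw : ℝ) (n m : ℤ) (j : ℕ) (x y u : ℝ),
      Tendsto (fun ωp => qedBasis P ωp kx kw n m j x y u) (𝓝[>] 0) (𝓝 (llbBasis P kx n j x y))) ∧
    -- the central equations, for any absolutely summable potential
    (∀ V : ℤ → ℤ → ℂ, Summable (fun p : ℤ × ℤ => ‖V p.1 p.2‖) → ∀ kx kw : ℝ,
      -- both central equations are meaningful for bounded coefficient families
      (∀ ωp : ℝ, 0 < ωp → ∀ (U : ℤ → ℤ → ℕ → ℂ) (C : ℝ), (∀ n m, L2Bound C (U n m)) →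
        ∀ n m i, Summable (qedTerm P V ωp kx U n m i)) ∧
      (∀ (U : ℤ → ℕ → ℂ) (C : ℝ), (∀ n, L2Bound C (U n)) →
        ∀ n i, Summable (llbTerm P V kx U n i)) ∧
      ∀ (ωp : ℕ → ℝ), Tendsto ωp atTop (𝓝[>] 0) →
        ∀ (U : ℕ → ℤ → ℤ → ℕ → ℂ) (C : ℝ), (∀ ν n m, L2Bound C (U ν n m)) →
        ∀ (E : ℕ → ℝ) (E₀ : ℝ), Tendsto E atTop (𝓝 E₀) →
        -- the limiting coefficients do not depend on `m`
        (∀ U₀ : ℤ → ℕ → ℂ,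
          (∀ n m j, Tendsto (fun ν => U ν n m j) atTop (𝓝 (U₀ n j))) →
          (∀ n m i, Tendsto (fun ν => qedLHS P V (ωp ν) kx kw (U ν) (E ν) n m i) atTop
            (𝓝 (llbLHS P V kx U₀ E₀ n i))) ∧
          ((∀ n m i, Tendsto (fun ν => qedLHS P V (ωp ν) kx kw (U ν) (E ν) n m i) atTop (𝓝 0)) ↔
            ∀ n i, LLBRow P V kx U₀ E₀ n i)) ∧
        -- the limiting coefficients are summable in `m`: the labels `m` get summed up
        (∀ (W : ℤ → ℤ → ℕ → ℂ) (K : ℝ),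
          (∀ n m j, Tendsto (fun ν => U ν n m j) atTop (𝓝 (W n m j))) →
          (∀ n, Summable (fun m => √(∑' j, ‖W n m j‖ ^ 2)) ∧
            ∑' m, √(∑' j, ‖W n m j‖ ^ 2) ≤ K) →
          (∀ n m i, Tendsto (fun ν => qedLHS P V (ωp ν) kx kw (U ν) (E ν) n m i) atTop (𝓝 0)) →
          ∀ n i, LLBRow P V kx (fun n j => ∑' m, W n m j) E₀ n i)) ∧
    -- square cosine potential in the lowest Landau level: Harper's equation in `Φ₀ / Φ`
    (P.a₁ = P.a₂ → P.θ = Real.pi / 2 → ∀ V₀ : ℝ, V₀ ≠ 0 → ∀ (kx E : ℝ) (u : ℤ → ℂ),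
      (∀ n, LLBRow P (cosinePotential V₀) kx (lowestLevel u) E n 0) ↔
        Harper (Φ₀ P / Φ P) (P.a₁ * kx / (2 * Real.pi))
          ((E - P.hbar * ωc P / 2) / hopping P V₀) u) := by
  refine ⟨⟨tendsto_M P, tendsto_kinetic P, tendsto_Ω P, tendsto_μ_mul_Ω P,
    fun n m => tendsto_Gv P m n, tendsto_alphaMat P⟩, tendsto_qedBasis P, ?_,
    fun ha hθ V₀ hV₀ => forall_llbRow_cosine_iff_harper ha hθ hV₀⟩
  intro V hV kx kw
  refine ⟨fun ωp _ U C hU => summable_qedTerm P hV ωp kx hU,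
    fun U C hU => summable_llbTerm P hV kx hU, ?_⟩
  intro ωp hω U C hU E E₀ hE
  refine ⟨fun U₀ hU₀ => ?_, fun W K hW hWK h n i => ?_⟩
  · have hlim : ∀ n m i, Tendsto (fun ν => qedLHS P V (ωp ν) kx kw (U ν) (E ν) n m i) atTop
        (𝓝 (llbLHS P V kx U₀ E₀ n i)) := by
      intro n m i
      have := tendsto_qedLHS P hV kx kw hω hU hE (W := fun n _ j => U₀ n j) hU₀ n m i
      rwa [tsum_limitTerm] at this
    -- The label `m = 0` is an arbitrary choice, here and below, because the limit is the same for
    -- every `m`.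
    have hU₀b : ∀ n, L2Bound C (U₀ n) := fun n =>
      L2Bound.of_tendsto (fun ν => hU ν n 0) (hU₀ n 0)
    refine ⟨hlim, fun h n i => ⟨summable_llbTerm P hV kx hU₀b n i,
      tendsto_nhds_unique (hlim n 0 i) (h n 0 i)⟩, fun h n m i => ?_⟩
    rw [← (h n i).2]
    exact hlim n m i
  · exact llbRow_of_summed_labels P hV kx E₀
      (fun n m => (L2Bound.of_tendsto (fun ν => hU ν n m) (hW n m)).1) hWK fun m =>
      tendsto_nhds_unique (tendsto_qedLHS P hV kx kw hω hU hE hW n m i) (h n m i)
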